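/- Let $\mathcal A=\mathbb Z[v,v^{-1}]$, with fraction field $\mathbb Q(v)$, and let $d\ge 0$ be an integer. Let $\mathbf U=\mathbf U_v(\mathfrak{gl}_2)$ be the $\mathbb Q(v)$-algebra with generators $e,f,K_1^{\pm1},K_2^{\pm1}$ and relations $K_1K_2=K_2K_1$, $K_iK_i^{-1}=K_i^{-1}K_i=1$, $K_1eK_1^{-1}=ve$, $K_1fK_1^{-1}=v^{-1}f$, $K_2eK_2^{-1}=v^{-1}e$, $K_2fK_2^{-1}=vf$, and $$ef-fe=\frac{K_1K_2^{-1}-K_1^{-1}K_2}{v-v^{-1}}.$$ Put $K=K_1K_2^{-1}$ and equip $\mathbf U$ with the comultiplication $\Delta(e)=e\otimes 1+K\otimes e$, $\Delta(f)=f\otimes K^{-1}+1\otimes f$, $\Delta(K_i)=K_i\otimes K_i$ and the counit $e,f\mapsto 0$, $K_i\mapsto 1$. Let $E$ be the $\mathbf U$-module with $\mathbb Q(v)$-basis $e_1,e_2$ on which $e,f,K_1,K_2$ act by the matrices $$\begin{pmatrix}0&1\\0&0\end{pmatrix},\quad\begin{pmatrix}0&0\\1&0\end{pmatrix},\quad\begin{pmatrix}v&0\\0&1\end{pmatrix},\quad\begin{pmatrix}1&0\\0&v\end{pmatrix},$$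 and let $\rho_d:\mathbf U\to\operatorname{End}_{\mathbb Q(v)}(E^{\otimes d})$ be the resulting representation on the $d$-th tensor power (for $d=0$ it is given by the counit). For integers $n$ and natural numbers $m,t$ write $[n]=\dfrac{v^n-v^{-n}}{v-v^{-1}}$, $[m]!=[m][m-1]\cdots[1]$, and, for an element $X$ (invertible in the second formula) of a $\mathbb Q(v)$-algebra, $$X^{(m)}=\frac{X^m}{[m]!},\qquad \begin{bmatrix}X\\t\end{bmatrix}=\prod_{s=1}^{t}\frac{Xv^{-s+1}-X^{-1}v^{s-1}}{v^s-v^{-s}}.$$ Let $\mathbf U_{\mathcal A}$ be the $\mathcal A$-subalgebra of $\mathbf U$ generated by all $e^{(m)},f^{(m)}$ ($m\in\mathbb N$) and $K_1^{\pm1},K_2^{\pm1}$, and let the integral quantum Schur algebra $S_{\mathcal A}(2,d)$ be the image $\rho_d(\mathbf U_{\mathcal A})$. Write again $e,f,K_1,K_2$ for the images of the generators under $\rho_d$. **Theorem.** The elements $$e^{(a)}\begin{bmatrix}K_1\\b\end{bmatrix}f^{(c)}\qquad(a,b,c\in\mathbb N,\ a+b+c\le d)$$ are pairwise distinct and form an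 $\mathcal A$-basis of $S_{\mathcal A}(2,d)$. Likewise the elements $$f^{(a)}\begin{bmatrix}K_2\\b\end{bmatrix}e^{(c)}\qquad(a,b,c\in\mathbb N,\ a+b+c\le d)$$ are pairwise distinct and form an $\mathcal A$-basis of $S_{\mathcal A}(2,d)$. -/

import Mathlib

open scoped TensorProduct LaurentPolynomial

noncomputable section

namespace QSchur

/-- The ring `𝒜 = ℤ[v, v⁻¹]`. -/
abbrev A : Type := ℤ[T;T⁻¹]

/-- The field `ℚ(v)`, as the fraction field of `𝒜`. -/
abbrev Qv : Type := FractionRing A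

/-- The indeterminate `v`. -/
def v : Qv := algebraMap A Qv (LaurentPolynomial.T 1)

/-- The quantum integer `[n] = (vⁿ - v⁻ⁿ) / (v - v⁻¹)`. -/
def qInt (n : ℤ) : Qv := (v ^ n - v ^ (-n)) / (v - v⁻¹)

/-- The quantum factorial `[m]! = [m] [m-1] ⋯ [1]`. -/
def qFact (m : ℕ) : Qv := ∏ i ∈ Finset.range m, qInt ((i : ℤ) + 1)

section General

variable {B : Type*} [Ring B] [Algebra Qv B]

/-- The divided power `X⁽ᵐ⁾ = Xᵐ / [m]!`. -/
def divPow (X : B) (m : ℕ) : B := (qFact m)⁻¹ • X ^ m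

/-- The element `∏_{s=1}^{t} (X v^{-s+1} - X⁻¹ v^{s-1}) / (v^s - v^{-s})` attached to an
invertible `X`; the index `i` below is `s - 1`. -/
def qBinom (X : Bˣ) (t : ℕ) : B :=
  ((List.range t).map fun i : ℕ =>
    (v ^ ((i : ℤ) + 1) - v ^ (-((i : ℤ) + 1)))⁻¹ •
      (v ^ (-(i : ℤ)) • (X : B) - v ^ (i : ℤ) • ((X⁻¹ : Bˣ) : B))).prod

end General

/-- Names of the generators `e, f, K₁, K₁⁻¹, K₂, K₂⁻¹`. -/
inductive Gen : Type
  | e | f | K1 | K1i | K2 | K2i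

/-- The generators inside the free algebra. -/
abbrev g (x : Gen) : FreeAlgebra Qv Gen := FreeAlgebra.ι Qv x

/-- The defining relations of the quantized enveloping algebra of `gl₂`. -/
inductive Rel : FreeAlgebra Qv Gen → FreeAlgebra Qv Gen → Prop
  | comm : Rel (g .K1 * g .K2) (g .K2 * g .K1)
  | K1_inv : Rel (g .K1 * g .K1i) 1
  | inv_K1 : Rel (g .K1i * g .K1) 1
  | K2_inv : Rel (g .K2 * g .K2i) 1
  | inv_K2 : Rel (g .K2i * g .K2) 1
  | K1_e : Rel (g .K1 * g .e * g .K1i) (v • g .e)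
  | K1_f : Rel (g .K1 * g .f * g .K1i) (v⁻¹ • g .f)
  | K2_e : Rel (g .K2 * g .e * g .K2i) (v⁻¹ • g .e)
  | K2_f : Rel (g .K2 * g .f * g .K2i) (v • g .f)
  | e_f : Rel (g .e * g .f - g .f * g .e)
      ((v - v⁻¹)⁻¹ • (g .K1 * g .K2i - g .K1i * g .K2))

/-- The quantized enveloping algebra `𝐔 = 𝐔_v(gl₂)` over `ℚ(v)`. -/
def U : Type := RingQuot Rel

instance : Ring U := inferInstanceAs (Ring (RingQuot Rel))
instance : Algebra Qv U := inferInstanceAs (Algebra Qv (RingQuot Rel))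
instance : Algebra A U := inferInstanceAs (Algebra A (RingQuot Rel))
instance : IsScalarTower A Qv U := inferInstanceAs (IsScalarTower A Qv (RingQuot Rel))

namespace U

/-- The quotient map from the free algebra. -/
def mk : FreeAlgebra Qv Gen →ₐ[Qv] U := RingQuot.mkAlgHom Qv Rel

theorem mk_rel {x y : FreeAlgebra Qv Gen} (h : Rel x y) : mk x = mk y :=
  RingQuot.mkAlgHom_rel Qv h

/-- The generator `e`. -/
def e : U := mk (g .e)
/-- The generator `f`. -/
def f : U := mk (g .f)

/-- The generator `K₁`, invertible. -/
def K1 : Uˣ where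
  val := mk (g .K1)
  inv := mk (g .K1i)
  val_inv := by rw [← map_mul, mk_rel .K1_inv, map_one]
  inv_val := by rw [← map_mul, mk_rel .inv_K1, map_one]

/-- The generator `K₂`, invertible. -/
def K2 : Uˣ where
  val := mk (g .K2)
  inv := mk (g .K2i)
  val_inv := by rw [← map_mul, mk_rel .K2_inv, map_one]
  inv_val := by rw [← map_mul, mk_rel .inv_K2, map_one]

theorem commute_K1_K2 : K1 * K2 = K2 * K1 := by
  ext
  exact (map_mul mk _ _).symm.trans ((mk_rel .comm).trans (map_mul mk _ _))

theorem K1_e : (K1 : U) * e * ((K1⁻¹ : Uˣ) : U) = v • e := by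
  have h := mk_rel .K1_e
  rwa [map_mul, map_mul, map_smul] at h

theorem K1_f : (K1 : U) * f * ((K1⁻¹ : Uˣ) : U) = v⁻¹ • f := by
  have h := mk_rel .K1_f
  rwa [map_mul, map_mul, map_smul] at h

theorem K2_e : (K2 : U) * e * ((K2⁻¹ : Uˣ) : U) = v⁻¹ • e := by
  have h := mk_rel .K2_e
  rwa [map_mul, map_mul, map_smul] at h

theorem K2_f : (K2 : U) * f * ((K2⁻¹ : Uˣ) : U) = v • f := by
  have h := mk_rel .K2_f
  rwa [map_mul, map_mul, map_smul] at h

theorem e_f : e * f - f * e =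
    (v - v⁻¹)⁻¹ • ((K1 : U) * ((K2⁻¹ : Uˣ) : U) - ((K1⁻¹ : Uˣ) : U) * (K2 : U)) := by
  have h := mk_rel .e_f
  rwa [map_sub, map_mul, map_mul, map_smul, map_sub, map_mul, map_mul] at h

section Lift

variable {B : Type*} [Ring B] [Algebra Qv B]

/-- The algebra homomorphism out of `𝐔` given by a choice of elements of `B` satisfying the
defining relations. -/
def lift (x y : B) (k l : Bˣ) (hc : k * l = l * k)
    (h1 : (k : B) * x = v • (x * (k : B))) (h2 : (k : B) * y = v⁻¹ • (y * (k : B)))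
    (h3 : (l : B) * x = v⁻¹ • (x * (l : B))) (h4 : (l : B) * y = v • (y * (l : B)))
    (h5 : x * y - y * x = (v - v⁻¹)⁻¹ •
      ((k : B) * ((l⁻¹ : Bˣ) : B) - ((k⁻¹ : Bˣ) : B) * (l : B))) : U →ₐ[Qv] B :=
  RingQuot.liftAlgHom Qv ⟨FreeAlgebra.lift Qv fun
    | .e => x
    | .f => y
    | .K1 => (k : B)
    | .K1i => ((k⁻¹ : Bˣ) : B)
    | .K2 => (l : B)
    | .K2i => ((l⁻¹ : Bˣ) : B), by
      intro a b hab
      have hc' : (k : B) * (l : B) = (l : B) * (k : B) := congrArg Units.val hc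
      cases hab <;> simp [h1, h2, h3, h4, h5, hc']⟩

end Lift

/-- The element `K = K₁ K₂⁻¹`. -/
def K : Uˣ := K1 * K2⁻¹

end U

theorem v_ne_zero : v ≠ 0 := by
  rw [v, Ne, FaithfulSMul.algebraMap_eq_zero_iff]
  exact (LaurentPolynomial.isUnit_T 1).ne_zero

theorem v_sub_ne_zero : v - v⁻¹ ≠ 0 := by
  intro h
  have h1 : v * v = 1 := by
    have h2 := congrArg (fun x => x * v) h
    simp only [sub_mul, inv_mul_cancel₀ v_ne_zero, zero_mul] at h2
    exact sub_eq_zero.mp h2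
  rw [v, ← map_mul, ← LaurentPolynomial.T_add, ← map_one (algebraMap A Qv)] at h1
  have h3 := FaithfulSMul.algebraMap_injective A Qv h1
  rw [← LaurentPolynomial.T_zero] at h3
  have h4 := congrArg LaurentPolynomial.degree h3
  rw [LaurentPolynomial.degree_T, LaurentPolynomial.degree_T] at h4
  exact absurd (WithBot.coe_injective h4) (by norm_num)

/-- `𝐔 ⊗ 𝐔` -/
abbrev UU : Type := U ⊗[Qv] U

/-- The unit `a ⊗ a` of `𝐔 ⊗ 𝐔`. -/
def grp (a : Uˣ) : UUˣ where
  val := (a : U) ⊗ₜ[Qv] (a : U)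
  inv := ((a⁻¹ : Uˣ) : U) ⊗ₜ[Qv] ((a⁻¹ : Uˣ) : U)
  val_inv := by simp [Algebra.TensorProduct.one_def]
  inv_val := by simp [Algebra.TensorProduct.one_def]

namespace U

theorem comm_of {a : Uˣ} {x : U} {c : Qv} (h : (a : U) * x * ((a⁻¹ : Uˣ) : U) = c • x) :
    (a : U) * x = c • (x * (a : U)) := by
  rw [← smul_mul_assoc, ← h, mul_assoc, Units.inv_mul, mul_one]

theorem comm_inv {a : Uˣ} {x : U} {c : Qv} (hc : c ≠ 0) (h : (a : U) * x = c • (x * (a : U))) :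
    ((a⁻¹ : Uˣ) : U) * x = c⁻¹ • (x * ((a⁻¹ : Uˣ) : U)) := by
  rw [eq_inv_smul_iff₀ hc, ← mul_smul_comm, Units.inv_mul_eq_iff_eq_mul, ← mul_assoc, h,
    smul_mul_assoc, mul_assoc, Units.mul_inv, mul_one]

theorem K_e : (K : U) * e = (v * v) • (e * (K : U)) := by
  have h1 := comm_of K1_e
  have h2 := comm_inv (inv_ne_zero v_ne_zero) (comm_of K2_e)
  rw [K, Units.val_mul, mul_assoc, h2, mul_smul_comm, ← mul_assoc, h1, inv_inv, smul_mul_assoc,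
    smul_smul, mul_assoc]

theorem K_f : (K : U) * f = (v * v)⁻¹ • (f * (K : U)) := by
  have h1 := comm_of K1_f
  have h2 := comm_inv v_ne_zero (comm_of K2_f)
  rw [K, Units.val_mul, mul_assoc, h2, mul_smul_comm, ← mul_assoc, h1, smul_mul_assoc,
    smul_smul, mul_assoc, mul_inv]

theorem commute_Ki_K {a : Uˣ} (h1 : a * K1 = K1 * a) (h2 : a * K2 = K2 * a) :
    (a : U) * (K : U) = (K : U) * (a : U) := by
  have h : Commute a K := by
    have h2' : Commute a K2 := h2
    exact Commute.mul_right h1 h2'.inv_right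
  exact congrArg Units.val h

theorem commute_K1_K : (K1 : U) * (K : U) = (K : U) * (K1 : U) :=
  commute_Ki_K rfl commute_K1_K2

theorem commute_K2_K : (K2 : U) * (K : U) = (K : U) * (K2 : U) :=
  commute_Ki_K commute_K1_K2.symm rfl

theorem grp_comm_e {a : Uˣ} {c : Qv} (h : (a : U) * e = c • (e * (a : U)))
    (hK : (a : U) * (K : U) = (K : U) * (a : U)) :
    (grp a : UU) * (e ⊗ₜ[Qv] (1 : U) + (K : U) ⊗ₜ[Qv] e) =
      c • ((e ⊗ₜ[Qv] (1 : U) + (K : U) ⊗ₜ[Qv] e) * (grp a : UU)) := by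
  simp [grp, mul_add, add_mul, h, hK, TensorProduct.smul_tmul', TensorProduct.tmul_smul]

theorem grp_comm_f {a : Uˣ} {c : Qv} (h : (a : U) * f = c • (f * (a : U)))
    (hK : (a : U) * (K : U) = (K : U) * (a : U)) :
    (grp a : UU) * (f ⊗ₜ[Qv] ((K⁻¹ : Uˣ) : U) + (1 : U) ⊗ₜ[Qv] f) =
      c • ((f ⊗ₜ[Qv] ((K⁻¹ : Uˣ) : U) + (1 : U) ⊗ₜ[Qv] f) * (grp a : UU)) := by
  have hK' : (a : U) * ((K⁻¹ : Uˣ) : U) = ((K⁻¹ : Uˣ) : U) * (a : U) := by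
    have h1 : Commute a K := Units.ext hK
    exact congrArg Units.val h1.inv_right.eq
  simp [grp, mul_add, add_mul, h, hK', TensorProduct.smul_tmul', TensorProduct.tmul_smul]

theorem e_f' : e * f - f * e = (v - v⁻¹)⁻¹ • ((K : U) - ((K⁻¹ : Uˣ) : U)) := by
  have h : (K1⁻¹ * K2 : Uˣ) = K⁻¹ := by
    have h1 : Commute K1 K2 := commute_K1_K2
    rw [K, mul_inv_rev, inv_inv]
    exact h1.inv_left.eq
  rw [e_f, ← h, K, Units.val_mul, Units.val_mul]

theorem comul_e_f :
    (e ⊗ₜ[Qv] (1 : U) + (K : U) ⊗ₜ[Qv] e) * (f ⊗ₜ[Qv] ((K⁻¹ : Uˣ) : U) + (1 : U) ⊗ₜ[Qv] f) -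
      (f ⊗ₜ[Qv] ((K⁻¹ : Uˣ) : U) + (1 : U) ⊗ₜ[Qv] f) * (e ⊗ₜ[Qv] (1 : U) + (K : U) ⊗ₜ[Qv] e) =
    (v - v⁻¹)⁻¹ • ((grp K1 : UU) * (((grp K2)⁻¹ : UUˣ) : UU) -
      (((grp K1)⁻¹ : UUˣ) : UU) * (grp K2 : UU)) := by
  have hv := v_ne_zero
  have h1 : (grp K1 : UU) * (((grp K2)⁻¹ : UUˣ) : UU) = (K : U) ⊗ₜ[Qv] (K : U) := by
    change ((K1 : U) ⊗ₜ[Qv] (K1 : U)) * (((K2⁻¹ : Uˣ) : U) ⊗ₜ[Qv] ((K2⁻¹ : Uˣ) : U)) = _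
    rw [Algebra.TensorProduct.tmul_mul_tmul, K, Units.val_mul]
  have h2 : (((grp K1)⁻¹ : UUˣ) : UU) * (grp K2 : UU) =
      ((K⁻¹ : Uˣ) : U) ⊗ₜ[Qv] ((K⁻¹ : Uˣ) : U) := by
    change (((K1⁻¹ : Uˣ) : U) ⊗ₜ[Qv] ((K1⁻¹ : Uˣ) : U)) * ((K2 : U) ⊗ₜ[Qv] (K2 : U)) = _
    have h : (K1⁻¹ * K2 : Uˣ) = K⁻¹ := by
      have h1 : Commute K1 K2 := commute_K1_K2
      rw [K, mul_inv_rev, inv_inv]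
      exact h1.inv_left.eq
    rw [Algebra.TensorProduct.tmul_mul_tmul, ← h, Units.val_mul]
  have h3 : ((K : U) * f) ⊗ₜ[Qv] (e * ((K⁻¹ : Uˣ) : U)) =
      (f * (K : U)) ⊗ₜ[Qv] (((K⁻¹ : Uˣ) : U) * e) := by
    rw [K_f, comm_inv (mul_ne_zero hv hv) K_e, TensorProduct.tmul_smul,
      ← TensorProduct.smul_tmul']
  have h4 : (e * f) ⊗ₜ[Qv] ((K⁻¹ : Uˣ) : U) - (f * e) ⊗ₜ[Qv] ((K⁻¹ : Uˣ) : U) =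
      (v - v⁻¹)⁻¹ • ((K : U) ⊗ₜ[Qv] ((K⁻¹ : Uˣ) : U) -
        ((K⁻¹ : Uˣ) : U) ⊗ₜ[Qv] ((K⁻¹ : Uˣ) : U)) := by
    rw [← TensorProduct.sub_tmul, e_f', ← TensorProduct.smul_tmul', TensorProduct.sub_tmul]
  have h5 : (K : U) ⊗ₜ[Qv] (e * f) - (K : U) ⊗ₜ[Qv] (f * e) =
      (v - v⁻¹)⁻¹ • ((K : U) ⊗ₜ[Qv] (K : U) - (K : U) ⊗ₜ[Qv] ((K⁻¹ : Uˣ) : U)) := by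
    rw [← TensorProduct.tmul_sub, e_f', TensorProduct.tmul_smul, TensorProduct.tmul_sub]
  rw [h1, h2]
  simp only [mul_add, add_mul, Algebra.TensorProduct.tmul_mul_tmul, mul_one, one_mul, h3]
  rw [← sub_add_sub_cancel ((K : U) ⊗ₜ[Qv] (K : U)) ((K : U) ⊗ₜ[Qv] ((K⁻¹ : Uˣ) : U)) _,
    smul_add, ← h4, ← h5]
  abel

/-- The comultiplication of `𝐔`: `Δ(e) = e ⊗ 1 + K ⊗ e`, `Δ(f) = f ⊗ K⁻¹ + 1 ⊗ f`,
`Δ(Kᵢ) = Kᵢ ⊗ Kᵢ`. -/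
def comul : U →ₐ[Qv] UU :=
  lift (e ⊗ₜ[Qv] (1 : U) + (K : U) ⊗ₜ[Qv] e) (f ⊗ₜ[Qv] ((K⁻¹ : Uˣ) : U) + (1 : U) ⊗ₜ[Qv] f)
    (grp K1) (grp K2)
    (by
      have h := congrArg Units.val commute_K1_K2
      simp only [Units.val_mul] at h
      ext
      simp [grp, h])
    (grp_comm_e (comm_of K1_e) commute_K1_K) (grp_comm_f (comm_of K1_f) commute_K1_K)
    (grp_comm_e (comm_of K2_e) commute_K2_K) (grp_comm_f (comm_of K2_f) commute_K2_K)
    comul_e_f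

/-- The counit of `𝐔`. -/
def counit : U →ₐ[Qv] Qv :=
  lift 0 0 1 1 rfl (by simp) (by simp) (by simp) (by simp) (by simp)

end U

/-- The natural module `E`, with standard basis `e₁, e₂`. -/
abbrev E : Type := Fin 2 → Qv

/-- The invertible diagonal matrix with diagonal entries `a, b`. -/
def diagUnit (a b : Qvˣ) : (Matrix (Fin 2) (Fin 2) Qv)ˣ where
  val := !![(a : Qv), 0; 0, (b : Qv)]
  inv := !![((a⁻¹ : Qvˣ) : Qv), 0; 0, ((b⁻¹ : Qvˣ) : Qv)]
  val_inv := by simp [Matrix.one_fin_two]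
  inv_val := by simp [Matrix.one_fin_two]

/-- `v` as a unit of `ℚ(v)`. -/
def vUnit : Qvˣ := Units.mk0 v v_ne_zero

/-- The natural representation of `𝐔` by `2 × 2` matrices. -/
def natMatrix : U →ₐ[Qv] Matrix (Fin 2) (Fin 2) Qv :=
  U.lift !![0, 1; 0, 0] !![0, 0; 1, 0] (diagUnit vUnit 1) (diagUnit 1 vUnit)
    (by ext i j; fin_cases i <;> fin_cases j <;> simp [diagUnit, vUnit])
    (by simp [diagUnit, vUnit])
    (by simp [diagUnit, vUnit, v_ne_zero])
    (by simp [diagUnit, vUnit, v_ne_zero])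
    (by simp [diagUnit, vUnit])
    (by
      have hv := v_sub_ne_zero
      change !![(0 : Qv), 1; 0, 0] * !![0, 0; 1, 0] - !![0, 0; 1, 0] * !![0, 1; 0, 0] =
        (v - v⁻¹)⁻¹ • (!![v, 0; 0, 1] * !![((1⁻¹ : Qvˣ) : Qv), 0; 0, v⁻¹] -
          !![v⁻¹, 0; 0, ((1⁻¹ : Qvˣ) : Qv)] * !![1, 0; 0, v])
      ext i j
      fin_cases i <;> fin_cases j <;> simp
      · rw [inv_mul_cancel₀ hv]
      · rw [← neg_sub v v⁻¹, mul_neg, inv_mul_cancel₀ hv])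

/-- The natural representation `ρ` of `𝐔` on `E`. -/
def natRep : U →ₐ[Qv] Module.End Qv E :=
  ((Matrix.toLinAlgEquiv' : Matrix (Fin 2) (Fin 2) Qv ≃ₐ[Qv] Module.End Qv E) :
    Matrix (Fin 2) (Fin 2) Qv →ₐ[Qv] Module.End Qv E).comp natMatrix

/-- The tensor power `E^{⊗ d}`. -/
abbrev TE (d : ℕ) : Type := ⨂[Qv]^d E

/-- The identification `E^{⊗ d} ⊗ E = E^{⊗ (d+1)}`. -/
def succEquiv (d : ℕ) : TE d ⊗[Qv] E ≃ₗ[Qv] TE (d + 1) :=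
  (TensorProduct.congr (LinearEquiv.refl Qv (TE d))
    (PiTensorProduct.subsingletonEquiv (R := Qv) (s := fun _ => E) (0 : Fin 1)).symm).trans
    TensorPower.mulEquiv

/-- The representation `ρ_d` of `𝐔` on `E^{⊗ d}` obtained by iterating the comultiplication. -/
def rho : (d : ℕ) → U →ₐ[Qv] Module.End Qv (TE d)
  | 0 => (Algebra.ofId Qv (Module.End Qv (TE 0))).comp U.counit
  | d + 1 =>
    ((LinearEquiv.conjAlgEquiv Qv (succEquiv d) :
        Module.End Qv (TE d ⊗[Qv] E) ≃ₐ[Qv] Module.End Qv (TE (d + 1))) :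
      Module.End Qv (TE d ⊗[Qv] E) →ₐ[Qv] Module.End Qv (TE (d + 1))).comp
      ((Module.endTensorEndAlgHom (R := Qv) (S := Qv) (A := Qv) (M := TE d) (N := E)).comp
        ((Algebra.TensorProduct.map (rho d) natRep).comp U.comul))

/-- The `𝒜`-form of `𝐔`, generated over `𝒜` by all divided powers of `e` and `f` together with
`K₁^{±1}`, `K₂^{±1}`. -/
def UA : Subalgebra A U :=
  Algebra.adjoin A
    (Set.range (divPow U.e) ∪ Set.range (divPow U.f) ∪
      {(U.K1 : U), ((U.K1⁻¹ : Uˣ) : U), (U.K2 : U), ((U.K2⁻¹ : Uˣ) : U)})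

/-- The quantum Schur algebra `S_v(2, d)`, the image of `ρ_d`. -/
def S (d : ℕ) : Subalgebra Qv (Module.End Qv (TE d)) := (rho d).range

/-- The integral quantum Schur algebra `S_𝒜(2, d)`, the image of the `𝒜`-form of `𝐔`
under `ρ_d`. -/
def SA (d : ℕ) : Subalgebra A (Module.End Qv (TE d)) :=
  UA.map ((rho d).restrictScalars A)

/-- The image of `e` in the Schur algebra. -/
def eS (d : ℕ) : Module.End Qv (TE d) := rho d U.e

/-- The image of `f` in the Schur algebra. -/
def fS (d : ℕ) : Module.End Qv (TE d) := rho d U.f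

/-- The image of `K₁` in the Schur algebra. -/
def K1S (d : ℕ) : (Module.End Qv (TE d))ˣ := Units.map (rho d : U →* Module.End Qv (TE d)) U.K1

/-- The image of `K₂` in the Schur algebra. -/
def K2S (d : ℕ) : (Module.End Qv (TE d))ˣ := Units.map (rho d : U →* Module.End Qv (TE d)) U.K2

/-- Triples `(a, b, c)` of natural numbers with `a + b + c ≤ d`. -/
abbrev Idx (d : ℕ) : Type := {p : ℕ × ℕ × ℕ // p.1 + p.2.1 + p.2.2 ≤ d}

end QSchur

end

open scoped TensorProduct LaurentPolynomial

noncomputable section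

namespace QSchur

/-! ### Quantum integers and Gaussian binomial coefficients -/

/-! Let `(s, s')` be `(0, 1)` for the first basis and `(1, 0)` for the second. In the basis of words
of `E^{⊗ d}`, the divided power that turns `a` letters into `s` has a power of `v` at each pair of
words related in this way and zero elsewhere (`raises_e`, `raises_f`). The middle factor is
diagonal, with entries `gaussBinom (cnt s w) b`.

All generators commute with the Hecke operators on adjacent letters. Hence an element of the Schur
algebra is determined by its entries at one pair of words `(w', w)` from each orbit under
permutation of positions (`eq_zero_of_vanish_on_representatives`), and on the integral form these
entries lie in `𝒜` (`apply_mem_intRing`). The orbits are labelled by the numbers `a`, `b`, `c` of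
positions carrying the pairs `(s, s')`, `(s, s)`, `(s', s)`, that is, by `Idx d`.

The entry of a monomial at `(w', w)` is a sum over words `u` whose letters `s` occur only where both
`w'` and `w` have `s`, and which contain at least `b` of them. A nonzero entry therefore forces `b`
to be at most the number of pairs `(s, s)`. In case of equality only one `u` contributes, the orbit
has the label of the monomial, and the entry is a power of `v`. So monomials against orbits form a
triangular matrix over `𝒜` with unit diagonal, which gives independence and spanning at once
(`exists_basis_of_triangular`).

It remains to see that the monomials are integral, since the binomials in `K₁`, `K₂` are not among
the generators of `UA`. Expanding `e⁽ᵗ⁾ f⁽ᵗ⁾` puts the binomials in `K` into the image, Pascal's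
rule shifts their upper index, and a descending induction extracts every weight projection
(`projection_mem`). With these, every diagonal matrix given by an `𝒜`-valued function of `cnt 0` is
integral. -/

theorem algebraMap_T (n : ℤ) : algebraMap A Qv (LaurentPolynomial.T n) = v ^ n := by
  have hnat (m : ℕ) : algebraMap A Qv (LaurentPolynomial.T m) = v ^ m := by
    rw [v, ← map_pow, LaurentPolynomial.T_pow, mul_one]
  obtain ⟨m, rfl | rfl⟩ := n.eq_nat_or_neg
  · rw [hnat, zpow_natCast]
  · rw [zpow_neg, zpow_natCast]
    refine eq_inv_of_mul_eq_one_left ?_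
    rw [← hnat, ← map_mul, ← LaurentPolynomial.T_add, neg_add_cancel, LaurentPolynomial.T_zero,
      map_one]

theorem v_zpow_injective : Function.Injective fun n : ℤ => v ^ n := by
  intro m n h
  simp only [← algebraMap_T] at h
  have h' := congrArg LaurentPolynomial.degree (FaithfulSMul.algebraMap_injective A Qv h)
  rw [LaurentPolynomial.degree_T, LaurentPolynomial.degree_T] at h'
  exact WithBot.coe_injective h'

theorem v_zpow_sub_ne_zero {n : ℤ} (hn : n ≠ 0) : v ^ n - v ^ (-n) ≠ 0 := by
  intro h
  have := v_zpow_injective (sub_eq_zero.mp h)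
  omega

theorem qInt_ne_zero {n : ℤ} (hn : n ≠ 0) : qInt n ≠ 0 :=
  div_ne_zero (v_zpow_sub_ne_zero hn) v_sub_ne_zero

theorem qInt_succ_ne_zero (n : ℕ) : qInt ((n : ℤ) + 1) ≠ 0 := qInt_ne_zero (by omega)

@[simp] theorem qInt_zero : qInt 0 = 0 := by simp [qInt]

theorem qFact_zero : qFact 0 = 1 := by simp [qFact]

theorem qFact_succ (m : ℕ) : qFact (m + 1) = qFact m * qInt ((m : ℤ) + 1) := by
  rw [qFact, Finset.prod_range_succ, ← qFact]

theorem qFact_ne_zero (m : ℕ) : qFact m ≠ 0 :=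
  Finset.prod_ne_zero_iff.mpr fun i _ => qInt_succ_ne_zero i

/-- The Gaussian binomial coefficient `[n choose t]` for an integer `n`. -/
def gaussBinom (n : ℤ) (t : ℕ) : Qv := ∏ i ∈ Finset.range t, qInt (n - i) / qInt ((i : ℤ) + 1)

@[simp] theorem gaussBinom_zero (n : ℤ) : gaussBinom n 0 = 1 := by simp [gaussBinom]

theorem gaussBinom_succ (n : ℤ) (t : ℕ) :
    gaussBinom n (t + 1) = gaussBinom n t * (qInt (n - t) / qInt ((t : ℤ) + 1)) := by
  rw [gaussBinom, Finset.prod_range_succ, ← gaussBinom]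

theorem gaussBinom_eq_zero {n t : ℕ} (h : n < t) : gaussBinom n t = 0 :=
  Finset.prod_eq_zero (Finset.mem_range.mpr h) (by simp)

theorem gaussBinom_self (n : ℕ) : gaussBinom n n = 1 := by
  rw [gaussBinom, Finset.prod_div_distrib, ← Finset.prod_range_reflect, div_eq_one_iff_eq]
  · refine Finset.prod_congr rfl fun i hi => ?_
    have := Finset.mem_range.mp hi
    congr 1
    omega
  · exact Finset.prod_ne_zero_iff.mpr fun i _ => qInt_succ_ne_zero i

/-- Raising both arguments multiplies by `[n+1]/[t+1]`, and `[n+1] = v^(t+1) [n-t] + v^(t-n) [t+1]`.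
The rule serves both integrality and the shift of weights in `gaussBinom_shift_mem`. -/
theorem gaussBinom_pascal (n : ℤ) (t : ℕ) :
    gaussBinom (n + 1) (t + 1) =
      v ^ ((t : ℤ) + 1) * gaussBinom n (t + 1) + v ^ ((t : ℤ) - n) * gaussBinom n t := by
  have hv := v_ne_zero
  have hs := v_sub_ne_zero
  have key : ∀ t : ℕ, gaussBinom (n + 1) (t + 1) =
      gaussBinom n t * (qInt (n + 1) / qInt ((t : ℤ) + 1)) := by
    intro t
    induction t with
    | zero => simp [gaussBinom]
    | succ t ih =>
      rw [gaussBinom_succ, ih, gaussBinom_succ]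
      have h1 : n + 1 - ((t + 1 : ℕ) : ℤ) = n - t := by push_cast; ring
      rw [h1]
      have := qInt_succ_ne_zero t
      have := qInt_succ_ne_zero (t + 1)
      field_simp
  rw [key, gaussBinom_succ]
  have h : qInt (n + 1) = v ^ ((t : ℤ) + 1) * qInt (n - t) + v ^ ((t : ℤ) - n) *
      qInt ((t : ℤ) + 1) := by
    simp only [qInt, zpow_add₀ hv, zpow_sub₀ hv, zpow_neg, zpow_one, mul_inv, inv_div]
    field_simp
    ring
  have := qInt_succ_ne_zero t
  rw [h]
  field_simp

/-- The subring `𝒜` of `ℚ(v)`. -/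
def intRing : Subring Qv := (algebraMap A Qv).range

theorem zpow_v_mem (n : ℤ) : v ^ n ∈ intRing := ⟨_, algebraMap_T n⟩

theorem gaussBinom_mem (n t : ℕ) : gaussBinom n t ∈ intRing := by
  induction n generalizing t with
  | zero =>
    cases t with
    | zero => simp
    | succ t => rw [gaussBinom_eq_zero (Nat.succ_pos t)]; exact zero_mem _
  | succ n ih =>
    cases t with
    | zero => simp
    | succ t =>
      rw [Nat.cast_succ, gaussBinom_pascal]
      exact add_mem (mul_mem (zpow_v_mem _) (ih _)) (mul_mem (zpow_v_mem _) (ih _))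

/-! ### Words and the matrix model of the tensor power -/

/-- Words of length `d` in the letters `0, 1`. -/
def W : ℕ → Type
  | 0 => Unit
  | d + 1 => W d × Fin 2

instance instFintypeW : ∀ d, Fintype (W d)
  | 0 => inferInstanceAs (Fintype Unit)
  | d + 1 => letI := instFintypeW d; inferInstanceAs (Fintype (W d × Fin 2))

instance instDecidableEqW : ∀ d, DecidableEq (W d)
  | 0 => inferInstanceAs (DecidableEq Unit)
  | d + 1 => letI := instDecidableEqW d; inferInstanceAs (DecidableEq (W d × Fin 2))

/-- Square matrices indexed by words. -/
abbrev Mat (d : ℕ) : Type := Matrix (W d) (W d) Qv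

/-- The word `w` followed by the letter `i`. -/
abbrev W.snoc {d : ℕ} (w : W d) (i : Fin 2) : W (d + 1) := (w, i)

/-- The Kronecker product of a matrix indexed by words and a `2 × 2` matrix. -/
def kron {d : ℕ} (x : Mat d) (y : Matrix (Fin 2) (Fin 2) Qv) : Mat (d + 1) :=
  Matrix.kroneckerMap (· * ·) x y

section kron

variable {d : ℕ} (x x' : Mat d) (y y' : Matrix (Fin 2) (Fin 2) Qv)

theorem kron_apply (w' w : W d) (i' i : Fin 2) :
    kron x y (w'.snoc i') (w.snoc i) = x w' w * y i' i := rfl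

theorem kron_mul : kron x y * kron x' y' = kron (x * x') (y * y') :=
  (Matrix.mul_kronecker_mul x x' y y').symm

theorem kron_one_one : kron (1 : Mat d) 1 = 1 := Matrix.one_kronecker_one

theorem smul_kron (c : Qv) : kron (c • x) y = c • kron x y := Matrix.smul_kronecker c x y

theorem kron_smul (c : Qv) : kron x (c • y) = c • kron x y := Matrix.kronecker_smul c x y

theorem kron_zero : kron x 0 = 0 := Matrix.kronecker_zero x

theorem kron_pow (n : ℕ) : kron x y ^ n = kron (x ^ n) (y ^ n) := by
  induction n with
  | zero => simp [kron_one_one]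
  | succ n ih => rw [pow_succ, ih, kron_mul, ← pow_succ, ← pow_succ]

end kron

theorem W.ext_sum {d : ℕ} {M : Type*} [AddCommMonoid M] (F : W (d + 1) → M) :
    ∑ u, F u = ∑ u : W d, ∑ i : Fin 2, F (u.snoc i) :=
  Fintype.sum_prod_type (α₁ := W d) (α₂ := Fin 2) F

theorem Mat.ext_snoc {d : ℕ} {x y : Mat (d + 1)}
    (h : ∀ (w' w : W d) (i' i : Fin 2), x (w'.snoc i') (w.snoc i) = y (w'.snoc i') (w.snoc i)) :
    x = y :=
  Matrix.ext fun w' w => h w'.1 w.1 w'.2 w.2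

/-- The basis of `E^{⊗ d}` of pure tensors of standard basis vectors. -/
def wordBasis : ∀ d, Module.Basis (W d) Qv (TE d)
  | 0 => (Module.Basis.singleton Unit Qv).map
      (PiTensorProduct.isEmptyEquiv (R := Qv) (s := fun _ : Fin 0 => E) (Fin 0)).symm
  | d + 1 => ((wordBasis d).tensorProduct (Pi.basisFun Qv (Fin 2))).map (succEquiv d)

/-- Matrices of endomorphisms of `E^{⊗ d}`. -/
def mat (d : ℕ) : Module.End Qv (TE d) ≃ₐ[Qv] Mat d := LinearMap.toMatrixAlgEquiv (wordBasis d)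

/-- The representation `ρ_d` in matrix form. -/
def rep (d : ℕ) : U →ₐ[Qv] Mat d :=
  ((mat d : Module.End Qv (TE d) ≃ₐ[Qv] Mat d) : Module.End Qv (TE d) →ₐ[Qv] Mat d).comp (rho d)

theorem toMatrix_natRep (y : U) :
    LinearMap.toMatrix (Pi.basisFun Qv (Fin 2)) (Pi.basisFun Qv (Fin 2)) (natRep y) =
      natMatrix y := by
  exact LinearMap.toMatrix'_toLin' _

/-- The action of `𝐔 ⊗ 𝐔` on `E^{⊗ d} ⊗ E` in matrix form. -/
def repPair (d : ℕ) : UU →ₐ[Qv] Mat (d + 1) :=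
  ((mat (d + 1) : Module.End Qv (TE (d + 1)) ≃ₐ[Qv] Mat (d + 1)) :
    Module.End Qv (TE (d + 1)) →ₐ[Qv] Mat (d + 1)).comp
  (((LinearEquiv.conjAlgEquiv Qv (succEquiv d) :
        Module.End Qv (TE d ⊗[Qv] E) ≃ₐ[Qv] Module.End Qv (TE (d + 1))) :
      Module.End Qv (TE d ⊗[Qv] E) →ₐ[Qv] Module.End Qv (TE (d + 1))).comp
      ((Module.endTensorEndAlgHom (R := Qv) (S := Qv) (A := Qv) (M := TE d) (N := E)).comp
        (Algebra.TensorProduct.map (rho d) natRep)))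

theorem rep_succ (d : ℕ) (u : U) : rep (d + 1) u = repPair d (U.comul u) := rfl

theorem wordBasis_snoc {d : ℕ} (w : W d) (i : Fin 2) : wordBasis (d + 1) (w.snoc i) =
    succEquiv d ((wordBasis d).tensorProduct (Pi.basisFun Qv (Fin 2)) (w, i)) := by
  rw [← Module.Basis.map_apply]
  rfl

theorem wordBasis_repr_snoc {d : ℕ} (z : TE d ⊗[Qv] E) (w : W d) (i : Fin 2) :
    (wordBasis (d + 1)).repr (succEquiv d z) (w.snoc i) =
      ((wordBasis d).tensorProduct (Pi.basisFun Qv (Fin 2))).repr z (w, i) := by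
  have h : (((wordBasis d).tensorProduct (Pi.basisFun Qv (Fin 2))).map (succEquiv d)).repr
      (succEquiv d z) (w, i) = ((wordBasis d).tensorProduct (Pi.basisFun Qv (Fin 2))).repr z (w, i)
      := by
    rw [Module.Basis.map_repr, LinearEquiv.trans_apply, LinearEquiv.symm_apply_apply]
  exact h

theorem mat_apply (d : ℕ) (z : Module.End Qv (TE d)) :
    mat d z = LinearMap.toMatrix (wordBasis d) (wordBasis d) z := rfl

theorem mat_conj (d : ℕ) (x : Module.End Qv (TE d)) (y : Module.End Qv E) :
    mat (d + 1) ((succEquiv d).conjAlgEquiv Qv (TensorProduct.map x y)) =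
      kron (mat d x) (LinearMap.toMatrix (Pi.basisFun Qv (Fin 2)) (Pi.basisFun Qv (Fin 2)) y) := by
  refine Mat.ext_snoc fun w' w i' i => ?_
  rw [mat_apply, LinearMap.toMatrix_apply, wordBasis_snoc, LinearEquiv.conjAlgEquiv_apply,
    LinearMap.comp_apply, LinearMap.comp_apply, LinearEquiv.coe_coe, LinearEquiv.coe_coe,
    LinearEquiv.symm_apply_apply, wordBasis_repr_snoc, kron_apply, mat_apply,
    ← LinearMap.toMatrix_apply, TensorProduct.toMatrix_map]
  rfl

theorem repPair_tmul (d : ℕ) (x y : U) :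
    repPair d (x ⊗ₜ[Qv] y) = kron (rep d x) (natMatrix y) := by
  have h1 : repPair d (x ⊗ₜ[Qv] y) = mat (d + 1)
      ((succEquiv d).conjAlgEquiv Qv (TensorProduct.map (rho d x) (natRep y))) := by
    simp only [repPair, AlgHom.comp_apply, Algebra.TensorProduct.map_tmul,
      Module.endTensorEndAlgHom_apply]
    rfl
  rw [h1, mat_conj, toMatrix_natRep]
  rfl

section LiftValues

variable {B : Type*} [Ring B] [Algebra Qv B] {x y : B} {k l : Bˣ} (hc : k * l = l * k)
    (h1 : (k : B) * x = v • (x * (k : B))) (h2 : (k : B) * y = v⁻¹ • (y * (k : B)))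
    (h3 : (l : B) * x = v⁻¹ • (x * (l : B))) (h4 : (l : B) * y = v • (y * (l : B)))
    (h5 : x * y - y * x = (v - v⁻¹)⁻¹ •
      ((k : B) * ((l⁻¹ : Bˣ) : B) - ((k⁻¹ : Bˣ) : B) * (l : B)))

theorem U.lift_e : U.lift x y k l hc h1 h2 h3 h4 h5 U.e = x :=
  (RingQuot.liftAlgHom_mkAlgHom_apply ..).trans (FreeAlgebra.lift_ι_apply _ _)

theorem U.lift_f : U.lift x y k l hc h1 h2 h3 h4 h5 U.f = y :=
  (RingQuot.liftAlgHom_mkAlgHom_apply ..).trans (FreeAlgebra.lift_ι_apply _ _)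

theorem U.lift_K1 : U.lift x y k l hc h1 h2 h3 h4 h5 U.K1 = k :=
  (RingQuot.liftAlgHom_mkAlgHom_apply ..).trans (FreeAlgebra.lift_ι_apply _ _)

theorem U.lift_K1_inv : U.lift x y k l hc h1 h2 h3 h4 h5 (U.K1⁻¹ : Uˣ) = (k⁻¹ : Bˣ) :=
  (RingQuot.liftAlgHom_mkAlgHom_apply ..).trans (FreeAlgebra.lift_ι_apply _ _)

theorem U.lift_K2 : U.lift x y k l hc h1 h2 h3 h4 h5 U.K2 = l :=
  (RingQuot.liftAlgHom_mkAlgHom_apply ..).trans (FreeAlgebra.lift_ι_apply _ _)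

theorem U.lift_K2_inv : U.lift x y k l hc h1 h2 h3 h4 h5 (U.K2⁻¹ : Uˣ) = (l⁻¹ : Bˣ) :=
  (RingQuot.liftAlgHom_mkAlgHom_apply ..).trans (FreeAlgebra.lift_ι_apply _ _)

end LiftValues

/-- The number of letters `s` in a word. -/
def cnt (s : Fin 2) : ∀ {d : ℕ}, W d → ℕ
  | 0, _ => 0
  | _ + 1, w => cnt s w.1 + if w.2 = s then 1 else 0

theorem cnt_snoc (s : Fin 2) {d : ℕ} (w : W d) (i : Fin 2) :
    cnt s (w.snoc i) = cnt s w + if i = s then 1 else 0 := rfl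

theorem cnt_add_cnt {d : ℕ} (w : W d) : cnt 0 w + cnt 1 w = d := by
  induction d with
  | zero => rfl
  | succ d ih =>
    obtain ⟨w, i⟩ := w
    have := ih w
    change cnt 0 (w.snoc i) + cnt 1 (w.snoc i) = d + 1
    rw [cnt_snoc, cnt_snoc]
    fin_cases i <;> simp <;> omega

/-- The diagonal matrix whose entries are given by a function of the number of zeros. -/
def diagCnt (d : ℕ) : (ℕ → Qv) →ₐ[Qv] Mat d :=
  (Matrix.diagonalAlgHom Qv).comp (AlgHom.pi (R := Qv) fun w => Pi.evalAlgHom Qv _ (cnt 0 w))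

theorem diagonal_snoc {d : ℕ} (F : W (d + 1) → Qv) (G : W d → Qv) (a b : Qv)
    (h0 : ∀ w, F (W.snoc w 0) = G w * a) (h1 : ∀ w, F (W.snoc w 1) = G w * b) :
    Matrix.diagonal F = kron (Matrix.diagonal G) !![a, 0; 0, b] := by
  refine Mat.ext_snoc fun w' w i' i => ?_
  by_cases hw : w' = w
  · subst hw
    rw [kron_apply]
    by_cases hi : i' = i
    · subst hi
      rw [Matrix.diagonal_apply_eq, Matrix.diagonal_apply_eq]
      fin_cases i'
      · exact h0 w'
      · exact h1 w'
    · have hne : w'.snoc i' ≠ w'.snoc i := fun h => hi (congrArg Prod.snd h)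
      refine (Matrix.diagonal_apply_ne F hne).trans ?_
      rw [Matrix.diagonal_apply_eq]
      fin_cases i' <;> fin_cases i <;> simp at hi ⊢
  · rw [kron_apply, Matrix.diagonal_apply_ne _ hw, zero_mul, Matrix.diagonal_apply_ne]
    exact fun h => hw (congrArg Prod.fst h)

/-! ### Matrices of the generators and their recursion in `d` -/

theorem natMatrix_e : natMatrix U.e = !![0, 1; 0, 0] := U.lift_e ..
theorem natMatrix_f : natMatrix U.f = !![0, 0; 1, 0] := U.lift_f ..
theorem natMatrix_K1 : natMatrix U.K1 = !![v, 0; 0, 1] := by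
  refine (U.lift_K1 ..).trans ?_
  simp [diagUnit, vUnit]
theorem natMatrix_K1_inv : natMatrix (U.K1⁻¹ : Uˣ) = !![v⁻¹, 0; 0, 1] := by
  refine (U.lift_K1_inv ..).trans ?_
  change !![((vUnit⁻¹ : Qvˣ) : Qv), 0; 0, ((1⁻¹ : Qvˣ) : Qv)] = _
  simp [vUnit]
theorem natMatrix_K2 : natMatrix U.K2 = !![1, 0; 0, v] := by
  refine (U.lift_K2 ..).trans ?_
  simp [diagUnit, vUnit]
theorem natMatrix_K2_inv : natMatrix (U.K2⁻¹ : Uˣ) = !![1, 0; 0, v⁻¹] := by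
  refine (U.lift_K2_inv ..).trans ?_
  change !![((1⁻¹ : Qvˣ) : Qv), 0; 0, ((vUnit⁻¹ : Qvˣ) : Qv)] = _
  simp [vUnit]
theorem K_inv : U.K⁻¹ = U.K1⁻¹ * U.K2 := by
  have h1 : Commute U.K1 U.K2 := U.commute_K1_K2
  rw [U.K, mul_inv_rev, inv_inv]
  exact h1.inv_left.eq.symm
theorem natMatrix_K_inv : natMatrix (U.K⁻¹ : Uˣ) = !![v⁻¹, 0; 0, v] := by
  rw [K_inv, Units.val_mul, map_mul, natMatrix_K1_inv, natMatrix_K2]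
  simp

theorem comul_e : U.comul U.e = U.e ⊗ₜ[Qv] (1 : U) + (U.K : U) ⊗ₜ[Qv] U.e := U.lift_e ..
theorem comul_f : U.comul U.f = U.f ⊗ₜ[Qv] ((U.K⁻¹ : Uˣ) : U) + (1 : U) ⊗ₜ[Qv] U.f := U.lift_f ..
theorem comul_K1 : U.comul U.K1 = (U.K1 : U) ⊗ₜ[Qv] (U.K1 : U) := U.lift_K1 ..
theorem comul_K1_inv : U.comul (U.K1⁻¹ : Uˣ) =
    ((U.K1⁻¹ : Uˣ) : U) ⊗ₜ[Qv] ((U.K1⁻¹ : Uˣ) : U) := U.lift_K1_inv ..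
theorem comul_K2 : U.comul U.K2 = (U.K2 : U) ⊗ₜ[Qv] (U.K2 : U) := U.lift_K2 ..
theorem comul_K2_inv : U.comul (U.K2⁻¹ : Uˣ) =
    ((U.K2⁻¹ : Uˣ) : U) ⊗ₜ[Qv] ((U.K2⁻¹ : Uˣ) : U) := U.lift_K2_inv ..

theorem rep_zero (u : U) : rep 0 u = algebraMap Qv (Mat 0) (U.counit u) :=
  AlgEquiv.commutes (mat 0) _

theorem rep_zero_e : rep 0 U.e = 0 := by
  rw [rep_zero, show U.counit U.e = 0 from U.lift_e .., map_zero]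
theorem rep_zero_f : rep 0 U.f = 0 := by
  rw [rep_zero, show U.counit U.f = 0 from U.lift_f .., map_zero]

theorem rep_succ_e (d : ℕ) : rep (d + 1) U.e =
    kron (rep d U.e) 1 + kron (rep d U.K) !![0, 1; 0, 0] := by
  rw [rep_succ, comul_e, map_add, repPair_tmul, repPair_tmul, map_one, natMatrix_e]
theorem rep_succ_f (d : ℕ) : rep (d + 1) U.f =
    kron (rep d U.f) !![v⁻¹, 0; 0, v] + kron 1 !![0, 0; 1, 0] := by
  rw [rep_succ, comul_f, map_add, repPair_tmul, repPair_tmul, map_one, natMatrix_f,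
    natMatrix_K_inv]

theorem diagonal_zero_eq_one (F : W 0 → Qv) (h : ∀ w, F w = 1) :
    (1 : Mat 0) = Matrix.diagonal F := by
  rw [← Matrix.diagonal_one]
  congr 1
  ext w
  exact (h w).symm

theorem rep_K1 (d : ℕ) : rep d U.K1 = Matrix.diagonal fun w => v ^ (cnt 0 w : ℤ) := by
  induction d with
  | zero =>
    rw [rep_zero, show U.counit U.K1 = 1 from U.lift_K1 .., map_one]
    exact diagonal_zero_eq_one _ fun w => by simp [cnt]
  | succ d ih =>
    rw [rep_succ, comul_K1, repPair_tmul, ih, natMatrix_K1]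
    refine (diagonal_snoc _ _ _ _ (fun w => ?_) fun w => ?_).symm <;>
      simp [cnt_snoc, zpow_add_one₀ v_ne_zero]

theorem rep_K2 (d : ℕ) : rep d U.K2 = Matrix.diagonal fun w => v ^ (cnt 1 w : ℤ) := by
  induction d with
  | zero =>
    rw [rep_zero, show U.counit U.K2 = 1 from U.lift_K2 .., map_one]
    exact diagonal_zero_eq_one _ fun w => by simp [cnt]
  | succ d ih =>
    rw [rep_succ, comul_K2, repPair_tmul, ih, natMatrix_K2]
    refine (diagonal_snoc _ _ _ _ (fun w => ?_) fun w => ?_).symm <;>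
      simp [cnt_snoc, zpow_add_one₀ v_ne_zero]

theorem rep_inv_eq_diagonal {d : ℕ} (k : Uˣ) (F : W d → Qv) (hF : ∀ w, F w ≠ 0)
    (h : rep d k = Matrix.diagonal F) :
    rep d (k⁻¹ : Uˣ) = Matrix.diagonal fun w => (F w)⁻¹ := by
  have h1 : rep d (k⁻¹ : Uˣ) * Matrix.diagonal F = 1 := by
    rw [← h, ← map_mul, Units.inv_mul, map_one]
  have h2 : Matrix.diagonal F * (Matrix.diagonal fun w => (F w)⁻¹) = 1 := by
    rw [Matrix.diagonal_mul_diagonal, ← Matrix.diagonal_one]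
    congr 1
    ext w
    exact mul_inv_cancel₀ (hF w)
  exact left_inv_eq_right_inv h1 h2

theorem rep_K1_inv (d : ℕ) :
    rep d (U.K1⁻¹ : Uˣ) = Matrix.diagonal fun w => v ^ (-(cnt 0 w : ℤ)) := by
  rw [rep_inv_eq_diagonal _ _ (fun w => zpow_ne_zero _ v_ne_zero) (rep_K1 d)]
  simp only [zpow_neg]

theorem rep_K2_inv (d : ℕ) :
    rep d (U.K2⁻¹ : Uˣ) = Matrix.diagonal fun w => v ^ (-(cnt 1 w : ℤ)) := by
  rw [rep_inv_eq_diagonal _ _ (fun w => zpow_ne_zero _ v_ne_zero) (rep_K2 d)]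
  simp only [zpow_neg]

theorem rep_K (d : ℕ) :
    rep d U.K = Matrix.diagonal fun w => v ^ ((cnt 0 w : ℤ) - cnt 1 w) := by
  rw [U.K, Units.val_mul, map_mul, rep_K1, rep_K2_inv, Matrix.diagonal_mul_diagonal]
  simp only [← zpow_add₀ v_ne_zero, sub_eq_add_neg]

/-! ### Divided powers and Gaussian binomials in the matrix model -/

section DivPow

variable {B : Type*} [Ring B] [Algebra Qv B]

theorem divPow_zero (x : B) : divPow x 0 = 1 := by simp [divPow, qFact_zero]

theorem map_divPow {B' : Type*} [Ring B'] [Algebra Qv B'] (φ : B →ₐ[Qv] B') (x : B) (m : ℕ) :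
    φ (divPow x m) = divPow (φ x) m := by
  rw [divPow, divPow, map_smul, map_pow]

/-- For `q = v` or `q = v⁻¹`, `q^n [n+1] = 1 + q² + ⋯ + q^(2n)`; this is one step of that geometric
sum. -/
theorem zpow_mul_qInt_succ {q : Qv} (hq : q = v ∨ q = v⁻¹) (n : ℕ) :
    q ^ (n + 1) * qInt (((n + 1 : ℕ) : ℤ) + 1) = 1 + q * q * (q ^ n * qInt ((n : ℤ) + 1)) := by
  have hv := v_ne_zero
  have hs := v_sub_ne_zero
  simp only [qInt]
  rw [mul_div_assoc', mul_div_assoc', mul_div_assoc', ← sub_eq_iff_eq_add, ← sub_div,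
    div_eq_one_iff_eq hs]
  push_cast
  rcases hq with rfl | rfl <;>
  · simp only [neg_add, zpow_add₀ hv, zpow_neg, zpow_one, zpow_natCast, inv_pow, pow_succ]
    have := pow_ne_zero n hv
    field_simp
    ring

theorem add_pow_of_skew {x y : B} {q : Qv} (hq : q = v ∨ q = v⁻¹)
    (hyx : y * x = (q * q) • (x * y)) (hyy : y * y = 0) (n : ℕ) :
    (x + y) ^ (n + 1) = x ^ (n + 1) + (q ^ n * qInt ((n : ℤ) + 1)) • (x ^ n * y) := by
  induction n with
  | zero => simp [qInt, div_self v_sub_ne_zero]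
  | succ n ih =>
    rw [pow_succ, ih, zpow_mul_qInt_succ hq]
    simp only [add_mul, mul_add, smul_mul_assoc, mul_assoc, hyx, hyy, mul_zero, smul_zero,
      mul_smul_comm, add_zero, add_smul, one_smul, smul_smul, ← pow_succ]
    rw [← mul_assoc (x ^ n) x y, ← pow_succ, show q * (q * (q ^ n * qInt ((n : ℤ) + 1))) =
      q ^ n * (qInt ((n : ℤ) + 1) * (q * q)) by ring]
    abel

/-- As `y² = 0`, the quantum binomial theorem has only two terms, and its coefficient `[n+1]`
cancels against `[n+1]!`. No denominator survives, so the entries stay powers of `v`. -/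
theorem divPow_add_of_skew {x y : B} {q : Qv} (hq : q = v ∨ q = v⁻¹)
    (hyx : y * x = (q * q) • (x * y)) (hyy : y * y = 0) (n : ℕ) :
    divPow (x + y) (n + 1) = divPow x (n + 1) + q ^ n • (divPow x n * y) := by
  have h1 := qFact_ne_zero n
  have h2 := qInt_succ_ne_zero n
  simp only [divPow]
  rw [add_pow_of_skew hq hyx hyy, smul_add, smul_smul, smul_mul_assoc, smul_smul, qFact_succ]
  congr 2
  field_simp

end DivPow

theorem divPow_kron {d : ℕ} (x : Mat d) (y : Matrix (Fin 2) (Fin 2) Qv) (n : ℕ) :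
    divPow (kron x y) n = kron (divPow x n) (y ^ n) := by
  rw [divPow, divPow, kron_pow, smul_kron]

/-- The summands `x = e ⊗ 1` and `y = K ⊗ e` of `Δ(e)` satisfy `y x = v² x y`, and `y² = 0` because
`e² = 0` on `E`. -/
theorem divPow_e_succ (d n : ℕ) : divPow (rep (d + 1) U.e) (n + 1) =
    kron (divPow (rep d U.e) (n + 1)) 1 +
      v ^ n • kron (divPow (rep d U.e) n * rep d U.K) !![0, 1; 0, 0] := by
  rw [rep_succ_e, divPow_add_of_skew (Or.inl rfl), divPow_kron, divPow_kron, kron_mul, one_pow,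
    one_pow, one_mul]
  · rw [kron_mul, kron_mul, mul_one, one_mul, ← map_mul, U.K_e, map_smul, map_mul, smul_kron]
  · rw [kron_mul, show (!![0, 1; 0, 0] : Matrix (Fin 2) (Fin 2) Qv) * !![0, 1; 0, 0] = 0 by
      ext i j; fin_cases i <;> fin_cases j <;> simp, kron_zero]

/-- Here `q = v⁻¹`; the factor `v⁻ⁿ` disappears because `K⁻ⁿ` acts on `e₂` by `vⁿ`. -/
theorem divPow_f_succ (d n : ℕ) : divPow (rep (d + 1) U.f) (n + 1) =
    kron (divPow (rep d U.f) (n + 1)) !![v⁻¹ ^ (n + 1), 0; 0, v ^ (n + 1)] +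
      kron (divPow (rep d U.f) n) !![0, 0; 1, 0] := by
  have hD (m : ℕ) : (!![v⁻¹, 0; 0, v] : Matrix (Fin 2) (Fin 2) Qv) ^ m =
      !![v⁻¹ ^ m, 0; 0, v ^ m] := by
    induction m with
    | zero => simp [Matrix.one_fin_two]
    | succ m ih => rw [pow_succ, ih]; simp [pow_succ]
  have hv := v_ne_zero
  rw [rep_succ_f, divPow_add_of_skew (Or.inr rfl), divPow_kron, divPow_kron, kron_mul, hD, hD,
    mul_one, ← kron_smul]
  · congr 2
    ext i j
    fin_cases i <;> fin_cases j <;> simp [hv]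
  · rw [kron_mul, kron_mul, mul_one, one_mul, ← kron_smul]
    congr 1
    ext i j
    fin_cases i <;> fin_cases j <;> simp [hv]
  · rw [kron_mul, show (!![0, 0; 1, 0] : Matrix (Fin 2) (Fin 2) Qv) * !![0, 0; 1, 0] = 0 by
      ext i j; fin_cases i <;> fin_cases j <;> simp, kron_zero]

/-! ### Entries of divided powers -/

/-- Every occurrence of `s` in the first word is an occurrence of `s` in the second one. -/
def LetterLE (s : Fin 2) : ∀ {d : ℕ}, W d → W d → Prop
  | 0, _, _ => True
  | _ + 1, u, w => LetterLE s u.1 w.1 ∧ (u.2 = s → w.2 = s)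

theorem letterLE_snoc {s : Fin 2} {d : ℕ} {u w : W d} {i j : Fin 2} :
    LetterLE s (u.snoc i) (w.snoc j) ↔ LetterLE s u w ∧ (i = s → j = s) := Iff.rfl

theorem LetterLE.refl (s : Fin 2) {d : ℕ} (w : W d) : LetterLE s w w := by
  induction d with
  | zero => trivial
  | succ d ih => exact ⟨ih w.1, id⟩

theorem LetterLE.cnt_le {s : Fin 2} {d : ℕ} {u w : W d} (h : LetterLE s u w) :
    cnt s u ≤ cnt s w := by
  induction d with
  | zero => exact le_rfl
  | succ d ih =>
    obtain ⟨u, i⟩ := u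
    obtain ⟨w, j⟩ := w
    obtain ⟨h1, h2⟩ := letterLE_snoc.mp h
    have := ih h1
    change cnt s (u.snoc i) ≤ cnt s (w.snoc j)
    rw [cnt_snoc, cnt_snoc]
    split_ifs with hi hj
    · omega
    · exact absurd (h2 hi) hj
    · omega
    · omega

theorem LetterLE.eq_of_cnt_eq {s : Fin 2} {d : ℕ} {u w : W d} (h : LetterLE s u w)
    (hc : cnt s w = cnt s u) : u = w := by
  induction d with
  | zero => rfl
  | succ d ih =>
    obtain ⟨u, i⟩ := u
    obtain ⟨w, j⟩ := w
    obtain ⟨h1, h2⟩ := letterLE_snoc.mp h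
    have hle := h1.cnt_le
    change cnt s (w.snoc j) = cnt s (u.snoc i) at hc
    rw [cnt_snoc, cnt_snoc] at hc
    have hij : i = s ↔ j = s := by
      refine ⟨h2, fun hj => ?_⟩
      by_contra hi
      rw [if_pos hj, if_neg hi] at hc
      omega
    have huw : u = w := ih h1 (by simpa [hij] using hc)
    have : i = j := by omega
    rw [huw, this]

/-- The family `X` of matrices behaves like the divided powers of an operator turning letters
into `s`: the entry of `X a` at `(w', w)` is a power of `v` when `w'` arises from `w` by changing
`a` letters into `s`, and is zero otherwise. -/
def Raises (s : Fin 2) {d : ℕ} (X : ℕ → Mat d) : Prop :=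
  ∀ a w' w, (LetterLE s w w' → cnt s w' = cnt s w + a → ∃ k : ℤ, X a w' w = v ^ k) ∧
    (X a w' w ≠ 0 → LetterLE s w w' ∧ cnt s w' = cnt s w + a)

theorem Raises.of_one {s : Fin 2} {d : ℕ} {X : ℕ → Mat d} (h0 : X 0 = 1)
    (h : ∀ a w' w,
      (LetterLE s w w' → cnt s w' = cnt s w + (a + 1) → ∃ k : ℤ, X (a + 1) w' w = v ^ k) ∧
      (X (a + 1) w' w ≠ 0 → LetterLE s w w' ∧ cnt s w' = cnt s w + (a + 1))) : Raises s X := by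
  rintro (_ | a) w' w
  · rw [h0]
    refine ⟨fun h1 h2 => ⟨0, ?_⟩, fun hne => ?_⟩
    · rw [h1.eq_of_cnt_eq h2, Matrix.one_apply_eq, zpow_zero]
    · by_cases hw : w' = w
      · subst hw
        exact ⟨LetterLE.refl s _, rfl⟩
      · exact absurd (Matrix.one_apply_ne hw) hne
  · exact h a w' w

theorem Raises.zero {s : Fin 2} {X : ℕ → Mat 0} (h0 : X 0 = 1) (h : ∀ a, X (a + 1) = 0) :
    Raises s X :=
  Raises.of_one h0 fun a w' w =>
    ⟨fun _ hc => absurd hc (by simp [cnt]), fun hne => absurd (by rw [h]; rfl) hne⟩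

/-- The last letter is either kept, with all `a + 1` changes before it, or turned into `s`, with `a`
changes before it; it never turns away from `s`. So an entry of `Y` is a power of `v` times a single
entry of `X`, never a sum. -/
theorem Raises.succ {s : Fin 2} {d : ℕ} {X : ℕ → Mat d} {Y : ℕ → Mat (d + 1)}
    (hX : Raises s X) (h0 : Y 0 = 1)
    (hdiag : ∀ a w' w i, ∃ k : ℤ, Y (a + 1) (W.snoc w' i) (W.snoc w i) = v ^ k * X (a + 1) w' w)
    (hup : ∀ a w' w i, i ≠ s → ∃ k : ℤ, Y (a + 1) (W.snoc w' s) (W.snoc w i) = v ^ k * X a w' w)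
    (hdown : ∀ a w' w i, i ≠ s → Y (a + 1) (W.snoc w' i) (W.snoc w s) = 0) : Raises s Y := by
  refine Raises.of_one h0 fun a => ?_
  rintro ⟨w', i'⟩ ⟨w, i⟩
  change (LetterLE s (w.snoc i) (w'.snoc i') →
    cnt s (w'.snoc i') = cnt s (w.snoc i) + (a + 1) →
    ∃ k : ℤ, Y (a + 1) (w'.snoc i') (w.snoc i) = v ^ k) ∧
    (Y (a + 1) (w'.snoc i') (w.snoc i) ≠ 0 → LetterLE s (w.snoc i) (w'.snoc i') ∧
      cnt s (w'.snoc i') = cnt s (w.snoc i) + (a + 1))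
  rw [letterLE_snoc, cnt_snoc, cnt_snoc]
  have hv := v_ne_zero
  by_cases hii : i' = i
  · subst hii
    obtain ⟨k, hk⟩ := hdiag a w' w i'
    obtain ⟨h1, h2⟩ := hX (a + 1) w' w
    refine ⟨fun hle hc => ?_, fun hne => ?_⟩
    · obtain ⟨l, hl⟩ := h1 hle.1 (by omega)
      exact ⟨k + l, by rw [hk, hl, zpow_add₀ hv]⟩
    · rw [hk] at hne
      obtain ⟨h3, h4⟩ := h2 (right_ne_zero_of_mul hne)
      exact ⟨⟨h3, id⟩, by omega⟩
  · by_cases his : i = s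
    · subst his
      refine ⟨fun hle => absurd (hle.2 rfl) hii, fun hne => absurd (hdown a w' w i' hii) hne⟩
    · have : i' = s := by omega
      subst this
      obtain ⟨k, hk⟩ := hup a w' w i his
      obtain ⟨h1, h2⟩ := hX a w' w
      rw [if_pos rfl, if_neg his]
      refine ⟨fun hle hc => ?_, fun hne => ?_⟩
      · obtain ⟨l, hl⟩ := h1 hle.1 (by omega)
        exact ⟨k + l, by rw [hk, hl, zpow_add₀ hv]⟩
      · rw [hk] at hne
        obtain ⟨h3, h4⟩ := h2 (right_ne_zero_of_mul hne)
        exact ⟨⟨h3, fun h => absurd h his⟩, by omega⟩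

theorem raises_e (d : ℕ) : Raises 0 (divPow (rep d U.e)) := by
  induction d with
  | zero => exact Raises.zero (divPow_zero _) fun a => by simp [divPow, rep_zero_e]
  | succ d ih =>
    refine ih.succ (divPow_zero _) (fun a w' w i => ⟨0, ?_⟩) (fun a w' w i hi => ?_)
      fun a w' w i hi => ?_
    · rw [divPow_e_succ, Matrix.add_apply, Matrix.smul_apply, kron_apply, kron_apply]
      fin_cases i <;> simp
    · obtain rfl : i = 1 := by omega
      refine ⟨a + ((cnt 0 w : ℤ) - cnt 1 w), ?_⟩
      rw [divPow_e_succ, Matrix.add_apply, Matrix.smul_apply, kron_apply, kron_apply, rep_K,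
        Matrix.mul_diagonal, zpow_add₀ v_ne_zero]
      simp
      ring
    · obtain rfl : i = 1 := by omega
      rw [divPow_e_succ, Matrix.add_apply, Matrix.smul_apply, kron_apply, kron_apply]
      simp

theorem raises_f (d : ℕ) : Raises 1 (divPow (rep d U.f)) := by
  induction d with
  | zero => exact Raises.zero (divPow_zero _) fun a => by simp [divPow, rep_zero_f]
  | succ d ih =>
    refine ih.succ (divPow_zero _) (fun a w' w i => ?_) (fun a w' w i hi => ⟨0, ?_⟩)
      fun a w' w i hi => ?_
    · rw [divPow_f_succ, Matrix.add_apply, kron_apply, kron_apply]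
      fin_cases i
      · refine ⟨-((a + 1 : ℕ) : ℤ), ?_⟩
        rw [zpow_neg, zpow_natCast]
        simp [mul_comm]
      · refine ⟨((a + 1 : ℕ) : ℤ), ?_⟩
        rw [zpow_natCast]
        simp [mul_comm]
    · obtain rfl : i = 0 := by omega
      rw [divPow_f_succ, Matrix.add_apply, kron_apply, kron_apply]
      simp
    · obtain rfl : i = 0 := by omega
      rw [divPow_f_succ, Matrix.add_apply, kron_apply, kron_apply]
      simp

/-! ### Gaussian binomials of `K₁` and `K₂` as diagonal matrices -/

theorem qBinom_zero {B : Type*} [Ring B] [Algebra Qv B] (X : Bˣ) : qBinom X 0 = 1 := rfl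

theorem qBinom_succ {B : Type*} [Ring B] [Algebra Qv B] (X : Bˣ) (t : ℕ) :
    qBinom X (t + 1) = qBinom X t * ((v ^ ((t : ℤ) + 1) - v ^ (-((t : ℤ) + 1)))⁻¹ •
      (v ^ (-(t : ℤ)) • (X : B) - v ^ (t : ℤ) • ((X⁻¹ : Bˣ) : B))) := by
  simp [qBinom, List.range_succ]

theorem map_qBinom_diagonal {B : Type*} [Ring B] [Algebra Qv B] {d : ℕ} (φ : B →ₐ[Qv] Mat d)
    (X : Bˣ) (n : W d → ℤ) (h : φ X = Matrix.diagonal fun w => v ^ n w)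
    (h' : φ (X⁻¹ : Bˣ) = Matrix.diagonal fun w => v ^ (-n w)) (t : ℕ) :
    φ (qBinom X t) = Matrix.diagonal fun w => gaussBinom (n w) t := by
  have hv := v_ne_zero
  induction t with
  | zero => simp [qBinom_zero]
  | succ t ih =>
    rw [qBinom_succ, map_mul, ih, map_smul, map_sub, map_smul, map_smul, h, h',
      ← Matrix.diagonal_smul, ← Matrix.diagonal_smul, Matrix.diagonal_sub, ← Matrix.diagonal_smul,
      Matrix.diagonal_mul_diagonal]
    congr 1
    ext w
    rw [gaussBinom_succ]
    simp only [Pi.smul_apply, smul_eq_mul, qInt]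
    rw [div_div_div_cancel_right₀ v_sub_ne_zero, ← zpow_add₀ hv, ← zpow_add₀ hv, div_eq_inv_mul,
      neg_sub, neg_add_eq_sub, ← sub_eq_add_neg]

theorem map_qBinom {B B' : Type*} [Ring B] [Algebra Qv B] [Ring B'] [Algebra Qv B']
    (φ : B →ₐ[Qv] B') (X : Bˣ) (t : ℕ) :
    φ (qBinom X t) = qBinom (Units.map (φ : B →* B') X) t := by
  induction t with
  | zero => simp [qBinom_zero]
  | succ t ih =>
    rw [qBinom_succ, qBinom_succ, map_mul, ih, map_smul, map_sub, map_smul, map_smul]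
    rfl

theorem mat_rho (d : ℕ) (u : U) : mat d (rho d u) = rep d u := rfl

theorem mat_qBinom_K1 (d t : ℕ) :
    mat d (qBinom (K1S d) t) = Matrix.diagonal fun w => gaussBinom (cnt 0 w) t := by
  rw [K1S, ← map_qBinom, mat_rho, map_qBinom_diagonal _ _ _ (rep_K1 d) (rep_K1_inv d)]

theorem mat_qBinom_K2 (d t : ℕ) :
    mat d (qBinom (K2S d) t) = Matrix.diagonal fun w => gaussBinom (cnt 1 w) t := by
  rw [K2S, ← map_qBinom, mat_rho, map_qBinom_diagonal _ _ _ (rep_K2 d) (rep_K2_inv d)]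

theorem mat_divPow_e (d m : ℕ) : mat d (divPow (eS d) m) = divPow (rep d U.e) m := by
  rw [eS, ← map_divPow, mat_rho, map_divPow]

theorem mat_divPow_f (d m : ℕ) : mat d (divPow (fS d) m) = divPow (rep d U.f) m := by
  rw [fS, ← map_divPow, mat_rho, map_divPow]

/-! ### The commutant of the Hecke operators -/

/-- The coordinates of the quantum antisymmetric vector `e₁ ⊗ e₂ - v e₂ ⊗ e₁`. -/
def antisym (i : Fin 2 × Fin 2) : Qv := !![0, 1; -v, 0] i.1 i.2

/-- The matrix of size `4` projecting, up to a scalar, onto the quantum antisymmetric vector. -/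
def antisymMat : Matrix (Fin 2 × Fin 2) (Fin 2 × Fin 2) Qv :=
  Matrix.of fun i j => antisym i * antisym j

/-- The Kronecker product of a matrix indexed by words and a matrix acting on two more letters. -/
def kron₂ {d : ℕ} (x : Mat d) (y : Matrix (Fin 2 × Fin 2) (Fin 2 × Fin 2) Qv) : Mat (d + 2) :=
  fun w' w => x w'.1.1 w.1.1 * y (w'.1.2, w'.2) (w.1.2, w.2)

section kron₂

variable {d : ℕ} (x x' : Mat d) (y y' : Matrix (Fin 2 × Fin 2) (Fin 2 × Fin 2) Qv)

theorem kron₂_apply (w' w : W d) (i' j' i j : Fin 2) :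
    kron₂ x y ((w'.snoc i').snoc j') ((w.snoc i).snoc j) = x w' w * y (i', j') (i, j) := rfl

theorem kron_kron (a b : Matrix (Fin 2) (Fin 2) Qv) :
    kron (kron x a) b = kron₂ x (Matrix.kroneckerMap (· * ·) a b) := by
  refine Mat.ext_snoc fun w' w j' j => ?_
  exact mul_assoc _ _ _

theorem kron₂_add : kron₂ x (y + y') = kron₂ x y + kron₂ x y' := by
  ext w' w
  exact mul_add _ _ _

theorem kron₂_mul : kron₂ x y * kron₂ x' y' = kron₂ (x * x') (y * y') := by
  refine Mat.ext_snoc fun w' w j' j => ?_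
  rw [Matrix.mul_apply, W.ext_sum, W.ext_sum]
  change ∑ u : W d, ∑ k : Fin 2, ∑ l : Fin 2, (x w'.1 u * y (w'.2, j') (k, l)) *
    (x' u w.1 * y' (k, l) (w.2, j)) = (x * x') w'.1 w.1 * (y * y') (w'.2, j') (w.2, j)
  rw [Matrix.mul_apply, Matrix.mul_apply, Finset.sum_mul]
  refine Finset.sum_congr rfl fun u _ => ?_
  rw [Fintype.sum_prod_type, Finset.mul_sum]
  refine Finset.sum_congr rfl fun k _ => ?_
  rw [Finset.mul_sum]
  exact Finset.sum_congr rfl fun l _ => mul_mul_mul_comm _ _ _ _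

end kron₂

theorem commute_kron₂ {d : ℕ} (x : Mat d) {y y' : Matrix (Fin 2 × Fin 2) (Fin 2 × Fin 2) Qv}
    (h : y' * y = y * y') : kron₂ 1 y' * kron₂ x y = kron₂ x y * kron₂ 1 y' := by
  rw [kron₂_mul, kron₂_mul, one_mul, mul_one, h]

/-- The Hecke operator acting on the last two letters. -/
def heckeLast : ∀ d, Set (Mat (d + 1))
  | 0 => ∅
  | _ + 1 => {kron₂ 1 antisymMat}

/-- The Hecke operators, acting on two adjacent letters. -/
def heckeOps : ∀ d, Set (Mat d)
  | 0 => ∅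
  | d + 1 => (fun h => kron h 1) '' heckeOps d ∪ heckeLast d

/-- The algebra of matrices commuting with all Hecke operators. -/
def heckeCommutant (d : ℕ) : Subalgebra Qv (Mat d) := Subalgebra.centralizer Qv (heckeOps d)

theorem mem_heckeCommutant_succ {d : ℕ} {x : Mat (d + 1)} : x ∈ heckeCommutant (d + 1) ↔
    (∀ h ∈ heckeOps d, kron h 1 * x = x * kron h 1) ∧ ∀ h ∈ heckeLast d, h * x = x * h := by
  rw [heckeCommutant, Subalgebra.mem_centralizer_iff, heckeOps]
  constructor
  · exact fun h => ⟨fun g hg => h _ (Or.inl ⟨g, hg, rfl⟩), fun g hg => h g (Or.inr hg)⟩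
  · rintro ⟨h1, h2⟩ _ (⟨g, hg, rfl⟩ | hg)
    · exact h1 g hg
    · exact h2 _ hg

theorem kron_commute {d : ℕ} {x h : Mat d} (y : Matrix (Fin 2) (Fin 2) Qv) (hx : h * x = x * h) :
    kron h 1 * kron x y = kron x y * kron h 1 := by
  rw [kron_mul, kron_mul, one_mul, mul_one, hx]

theorem rep_zero_mem (u : U) : rep 0 u ∈ heckeCommutant 0 := by
  rw [heckeCommutant, Subalgebra.mem_centralizer_iff]
  exact fun g hg => hg.elim

theorem rep_succ_K1 (d : ℕ) : rep (d + 1) U.K1 = kron (rep d U.K1) !![v, 0; 0, 1] := by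
  rw [rep_succ, comul_K1, repPair_tmul, natMatrix_K1]
theorem rep_succ_K1_inv (d : ℕ) :
    rep (d + 1) (U.K1⁻¹ : Uˣ) = kron (rep d (U.K1⁻¹ : Uˣ)) !![v⁻¹, 0; 0, 1] := by
  rw [rep_succ, comul_K1_inv, repPair_tmul, natMatrix_K1_inv]
theorem rep_succ_K2 (d : ℕ) : rep (d + 1) U.K2 = kron (rep d U.K2) !![1, 0; 0, v] := by
  rw [rep_succ, comul_K2, repPair_tmul, natMatrix_K2]
theorem rep_succ_K2_inv (d : ℕ) :
    rep (d + 1) (U.K2⁻¹ : Uˣ) = kron (rep d (U.K2⁻¹ : Uˣ)) !![1, 0; 0, v⁻¹] := by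
  rw [rep_succ, comul_K2_inv, repPair_tmul, natMatrix_K2_inv]
theorem rep_succ_K (d : ℕ) : rep (d + 1) U.K = kron (rep d U.K) !![v, 0; 0, v⁻¹] := by
  rw [U.K, Units.val_mul, map_mul, map_mul, rep_succ_K1, rep_succ_K2_inv, kron_mul]
  simp

/-- `e₁ ⊗ e₂` and `e₂ ⊗ e₁` have the same eigenvalue `a b`, so the antisymmetric vector is an
eigenvector on both sides. -/
theorem antisymMat_comm_diag (a b : Qv) :
    antisymMat * Matrix.kroneckerMap (· * ·) !![a, 0; 0, b] !![a, 0; 0, b] =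
      Matrix.kroneckerMap (· * ·) !![a, 0; 0, b] !![a, 0; 0, b] * antisymMat := by
  ext ⟨i', j'⟩ ⟨i, j⟩
  rw [Matrix.mul_apply, Matrix.mul_apply, Fintype.sum_prod_type, Fintype.sum_prod_type]
  fin_cases i' <;> fin_cases j' <;> fin_cases i <;> fin_cases j <;>
    simp [antisymMat, antisym] <;> ring

theorem diag_mem {d : ℕ} {u : U} {a b : Qv}
    (h : ∀ d, rep (d + 1) u = kron (rep d u) !![a, 0; 0, b]) : rep d u ∈ heckeCommutant d := by
  induction d with
  | zero => exact rep_zero_mem u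
  | succ d ih =>
    refine mem_heckeCommutant_succ.mpr ⟨fun g hg => ?_, fun g hg => ?_⟩
    · rw [h]
      exact kron_commute _ (Subalgebra.mem_centralizer_iff Qv |>.mp ih g hg)
    · cases d with
      | zero => exact hg.elim
      | succ d =>
        rw [Set.mem_singleton_iff.mp hg, h, h, kron_kron]
        exact commute_kron₂ _ (antisymMat_comm_diag a b)

theorem rep_K1_mem (d : ℕ) : rep d U.K1 ∈ heckeCommutant d := diag_mem rep_succ_K1
theorem rep_K1_inv_mem (d : ℕ) : rep d (U.K1⁻¹ : Uˣ) ∈ heckeCommutant d := diag_mem rep_succ_K1_inv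
theorem rep_K2_mem (d : ℕ) : rep d U.K2 ∈ heckeCommutant d := diag_mem rep_succ_K2
theorem rep_K2_inv_mem (d : ℕ) : rep d (U.K2⁻¹ : Uˣ) ∈ heckeCommutant d := diag_mem rep_succ_K2_inv
theorem rep_K_mem (d : ℕ) : rep d U.K ∈ heckeCommutant d := diag_mem rep_succ_K

/-- On the last two letters `e ⊗ 1 + K ⊗ e` kills the antisymmetric vector, and its image pairs to
zero with it, so both products with `antisymMat` vanish. The other summand of `e` is the identity on
these letters. -/
theorem rep_e_mem (d : ℕ) : rep d U.e ∈ heckeCommutant d := by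
  have hv := v_ne_zero
  induction d with
  | zero => exact rep_zero_mem _
  | succ d ih =>
    refine mem_heckeCommutant_succ.mpr ⟨fun g hg => ?_, fun g hg => ?_⟩
    · rw [rep_succ_e, mul_add, add_mul,
        kron_commute _ (Subalgebra.mem_centralizer_iff Qv |>.mp ih g hg),
        kron_commute _ (Subalgebra.mem_centralizer_iff Qv |>.mp (rep_K_mem d) g hg)]
    · cases d with
      | zero => exact hg.elim
      | succ d =>
        rw [Set.mem_singleton_iff.mp hg, rep_succ_e, rep_succ_e, rep_succ_K,
          show kron (kron (rep d U.e) 1 + kron (rep d U.K) !![0, 1; 0, 0]) 1 =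
            kron (kron (rep d U.e) 1) 1 + kron (kron (rep d U.K) !![0, 1; 0, 0]) 1 from
            Matrix.add_kronecker _ _ _, kron_kron, kron_kron, kron_kron, add_assoc (kron₂ _ _),
          ← kron₂_add,
          mul_add, add_mul, commute_kron₂ _ (by rw [Matrix.one_kronecker_one, one_mul, mul_one]),
          commute_kron₂]
        ext ⟨i', j'⟩ ⟨i, j⟩
        rw [Matrix.mul_apply, Matrix.mul_apply, Fintype.sum_prod_type, Fintype.sum_prod_type]
        fin_cases i' <;> fin_cases j' <;> fin_cases i <;> fin_cases j <;>
          simp [antisymMat, antisym, hv]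

theorem rep_f_mem (d : ℕ) : rep d U.f ∈ heckeCommutant d := by
  have hv := v_ne_zero
  induction d with
  | zero => exact rep_zero_mem _
  | succ d ih =>
    refine mem_heckeCommutant_succ.mpr ⟨fun g hg => ?_, fun g hg => ?_⟩
    · rw [rep_succ_f, mul_add, add_mul,
        kron_commute _ (Subalgebra.mem_centralizer_iff Qv |>.mp ih g hg),
        kron_commute _ (show g * 1 = 1 * g by rw [one_mul, mul_one])]
    · cases d with
      | zero => exact hg.elim
      | succ d =>
        rw [Set.mem_singleton_iff.mp hg, rep_succ_f, rep_succ_f, ← kron_one_one (d := d),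
          show kron (kron (rep d U.f) !![v⁻¹, 0; 0, v] + kron 1 !![0, 0; 1, 0])
              !![v⁻¹, 0; 0, v] =
            kron (kron (rep d U.f) !![v⁻¹, 0; 0, v]) !![v⁻¹, 0; 0, v] +
              kron (kron 1 !![0, 0; 1, 0]) !![v⁻¹, 0; 0, v] from
            Matrix.add_kronecker _ _ _, kron_kron, kron_kron, kron_kron, add_assoc (kron₂ _ _),
          ← kron₂_add,
          mul_add, add_mul, commute_kron₂ _ (antisymMat_comm_diag _ _), commute_kron₂]
        ext ⟨i', j'⟩ ⟨i, j⟩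
        rw [Matrix.mul_apply, Matrix.mul_apply, Fintype.sum_prod_type, Fintype.sum_prod_type]
        fin_cases i' <;> fin_cases j' <;> fin_cases i <;> fin_cases j <;>
          simp [antisymMat, antisym, hv]

theorem hecke_relation {d : ℕ} {x : Mat (d + 2)} (hx : x ∈ heckeCommutant (d + 2)) (w' w : W d)
    (i' j' i j : Fin 2) :
    antisym (i', j') * (x ((w'.snoc 0).snoc 1) ((w.snoc i).snoc j) -
        v * x ((w'.snoc 1).snoc 0) ((w.snoc i).snoc j)) =
      (x ((w'.snoc i').snoc j') ((w.snoc 0).snoc 1) -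
        v * x ((w'.snoc i').snoc j') ((w.snoc 1).snoc 0)) * antisym (i, j) := by
  have h := (mem_heckeCommutant_succ.mp hx).2 _ (Set.mem_singleton _)
  have h1 := congrFun (congrFun h ((w'.snoc i').snoc j')) ((w.snoc i).snoc j)
  rw [Matrix.mul_apply, Matrix.mul_apply, W.ext_sum, W.ext_sum, W.ext_sum, W.ext_sum] at h1
  simp only [kron₂_apply] at h1
  rw [Finset.sum_eq_single w' (fun u _ hu => by simp [Matrix.one_apply_ne hu.symm]) (by simp),
    Finset.sum_eq_single w (fun u _ hu => by simp [Matrix.one_apply_ne hu]) (by simp)] at h1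
  simp only [Fin.sum_univ_two, Matrix.one_apply_eq, antisymMat, Matrix.of_apply, one_mul] at h1
  have h00 : antisym (0, 0) = 0 := rfl
  have h01 : antisym (0, 1) = 1 := rfl
  have h10 : antisym (1, 0) = -v := rfl
  have h11 : antisym (1, 1) = 0 := rfl
  rw [h00, h01, h10, h11] at h1
  linear_combination h1

theorem block_mem {d : ℕ} {x : Mat (d + 1)} (hx : x ∈ heckeCommutant (d + 1)) (i' i : Fin 2) :
    (Matrix.of fun w' w => x (W.snoc w' i') (W.snoc w i)) ∈ heckeCommutant d := by
  rw [heckeCommutant, Subalgebra.mem_centralizer_iff]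
  intro g hg
  have h := (mem_heckeCommutant_succ.mp hx).1 g hg
  ext w' w
  have h1 := congrFun (congrFun h (w'.snoc i')) (w.snoc i)
  rw [Matrix.mul_apply, Matrix.mul_apply, W.ext_sum, W.ext_sum] at h1
  rw [Matrix.mul_apply, Matrix.mul_apply]
  simpa [kron_apply, Matrix.one_apply] using h1

/-! ### Vanishing along orbits of pairs of words -/

/-- The list of pairs of letters of two words, the last pair coming first. -/
def labels : ∀ {d : ℕ}, W d → W d → List (Fin 2 × Fin 2)
  | 0, _, _ => []
  | _ + 1, w', w => (w'.2, w.2) :: labels w'.1 w.1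

theorem labels_snoc {d : ℕ} (w' w : W d) (i' i : Fin 2) :
    labels (w'.snoc i') (w.snoc i) = (i', i) :: labels w' w := rfl

theorem length_labels {d : ℕ} (w' w : W d) : (labels w' w).length = d := by
  induction d with
  | zero => rfl
  | succ d ih => exact congrArg (· + 1) (ih w'.1 w.1)

theorem labels_injective {d : ℕ} {u' u w' w : W d} (h : labels u' u = labels w' w) :
    u' = w' ∧ u = w := by
  induction d with
  | zero => exact ⟨rfl, rfl⟩
  | succ d ih =>
    obtain ⟨h1, h2⟩ := List.cons.inj h
    obtain ⟨h3, h4⟩ := ih h2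
    obtain ⟨h5, h6⟩ := Prod.mk.inj h1
    exact ⟨Prod.ext h3 h5, Prod.ext h4 h6⟩

theorem exists_labels_eq {d : ℕ} (L : List (Fin 2 × Fin 2)) (hL : L.length = d) :
    ∃ w' w : W d, labels w' w = L := by
  induction L generalizing d with
  | nil => subst hL; exact ⟨(), (), rfl⟩
  | cons a L ih =>
    subst hL
    obtain ⟨w', w, h⟩ := ih rfl
    exact ⟨W.snoc w' a.1, W.snoc w a.2, congrArg (List.cons a) h⟩

/-- The relations make the swapped entry a unit multiple of the original one, except that `X 0 1 0
1` and `X 1 0 1 0` differ by a multiple of `X 0 1 1 0`. The latter has label pairs `(0, 1)`, `(1,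
0)`, so a pair `(0, 0)` is lost; this is what allows an induction on their number. -/
theorem vanish_swap {X : Fin 2 → Fin 2 → Fin 2 → Fin 2 → Qv}
    (hX : ∀ i' j' i j, antisym (i', j') * (X 0 1 i j - v * X 1 0 i j) =
      (X i' j' 0 1 - v * X i' j' 1 0) * antisym (i, j)) {i' j' i j : Fin 2}
    (hlow : (i', i) = (0, 0) ∧ (j', j) = (1, 1) ∨ (i', i) = (1, 1) ∧ (j', j) = (0, 0) →
      X 0 1 1 0 = 0)
    (h : X j' i' j i = 0) : X i' j' i j = 0 := by
  have hv := v_ne_zero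
  have h00 : antisym (0, 0) = 0 := rfl
  have h01 : antisym (0, 1) = 1 := rfl
  have h10 : antisym (1, 0) = -v := rfl
  have h11 : antisym (1, 1) = 0 := rfl
  have H1 := hX 0 1 1 0
  have H2 := hX 0 1 0 1
  have H3 := hX 0 0 0 1
  have H4 := hX 1 1 0 1
  have H5 := hX 0 1 0 0
  have H6 := hX 0 1 1 1
  rw [h01, h10] at H1
  rw [h01] at H2
  rw [h01, h00] at H3
  rw [h01, h11] at H4
  rw [h01, h00] at H5
  rw [h01, h11] at H6
  replace H1 : X 0 1 1 0 - v * X 1 0 1 0 = -(v * X 0 1 0 1) + v * (v * X 0 1 1 0) := by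
    linear_combination H1
  replace H2 : X 1 0 0 1 = X 0 1 1 0 := mul_left_cancel₀ hv (by linear_combination -H2)
  replace H3 : X 0 0 0 1 = v * X 0 0 1 0 := by linear_combination -H3
  replace H4 : X 1 1 0 1 = v * X 1 1 1 0 := by linear_combination -H4
  replace H5 : X 0 1 0 0 = v * X 1 0 0 0 := by linear_combination H5
  replace H6 : X 0 1 1 1 = v * X 1 0 1 1 := by linear_combination H6
  clear hX
  fin_cases i' <;> fin_cases j' <;> fin_cases i <;> fin_cases j <;> simp_all

/-- A permutation is built from adjacent swaps: `cons` passes to the block with fixed last letters,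
`swap` is one Hecke relation. The bound in `hlow` is the same for all lists permuted into each
other. -/
theorem vanish_of_perm {L L' : List (Fin 2 × Fin 2)} (hL : L.Perm L') {d : ℕ} {x : Mat d}
    (hx : x ∈ heckeCommutant d)
    (hlow : ∀ w' w, (labels w' w).count (0, 0) < L.count (0, 0) → x w' w = 0)
    (h : ∀ w' w, labels w' w = L → x w' w = 0) : ∀ w' w, labels w' w = L' → x w' w = 0 := by
  induction hL generalizing d with
  | nil => exact h
  | @cons a l l' hl ih =>
    cases d with
    | zero => exact fun w' w hw => absurd hw (by simp [labels])
    | succ d =>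
      rintro ⟨w', i'⟩ ⟨w, i⟩ hw
      obtain ⟨rfl, hl'⟩ := List.cons.inj ((labels_snoc w' w i' i).symm.trans hw)
      refine ih (block_mem hx i' i) (fun u' u hu => ?_) (fun u' u hu => ?_) w' w hl'
      · refine hlow (u'.snoc i') (u.snoc i) ?_
        rw [labels_snoc, List.count_cons, List.count_cons]
        exact Nat.add_lt_add_right hu _
      · refine h (u'.snoc i') (u.snoc i) ?_
        rw [labels_snoc, hu]
  | swap a b l =>
    match d with
    | 0 => exact fun w' w hw => absurd hw (by simp [labels])
    | 1 => exact fun w' w hw => absurd hw (by simp [labels])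
    | d + 2 =>
      rintro ⟨⟨w', i'⟩, j'⟩ ⟨⟨w, i⟩, j⟩ hw
      obtain ⟨rfl, hl⟩ :=
        List.cons.inj ((labels_snoc (w'.snoc i') (w.snoc i) j' j).symm.trans hw)
      obtain ⟨rfl, rfl⟩ := List.cons.inj ((labels_snoc w' w i' i).symm.trans hl)
      refine vanish_swap (X := fun i' j' i j => x ((w'.snoc i').snoc j') ((w.snoc i).snoc j))
        (fun i' j' i j => hecke_relation hx w' w i' j' i j) (fun hc => ?_) (h _ _ rfl)
      refine hlow _ _ ?_
      rw [labels_snoc, labels_snoc]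
      rcases hc with ⟨h1, h2⟩ | ⟨h1, h2⟩ <;> rw [h1, h2] <;> simp
  | trans h1 h2 ih1 ih2 =>
    refine ih2 hx (fun w' w hw => hlow w' w ?_) (ih1 hx hlow h)
    rwa [h1.count_eq]

/-- Strong induction on the number of pairs `(0, 0)` supplies the vanishing that `vanish_of_perm`
needs for smaller counts. -/
theorem eq_zero_of_vanish_on_representatives {d : ℕ} {x : Mat d} (hx : x ∈ heckeCommutant d)
    (h : ∀ w' w : W d, ∃ u' u : W d, (labels u' u).Perm (labels w' w) ∧ x u' u = 0) : x = 0 := by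
  have key : ∀ (n : ℕ) (w' w : W d), (labels w' w).count (0, 0) = n → x w' w = 0 := by
    intro n
    induction n using Nat.strong_induction_on with
    | _ n ih =>
      intro w' w hn
      obtain ⟨u', u, hp, hu⟩ := h w' w
      refine vanish_of_perm hp hx (fun y' y hy => ih _ ?_ y' y rfl) (fun y' y hy => ?_) w' w rfl
      · rwa [hp.count_eq, hn] at hy
      · obtain ⟨rfl, rfl⟩ := labels_injective hy
        exact hu
  ext w' w
  exact key _ w' w rfl

/-! ### Integrality of the weight projections -/

theorem qInt_mul_add (j n : ℤ) :
    qInt j * qInt (n + 1 - j) + qInt (n - 2 * j) = qInt (j + 1) * qInt (n - j) := by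
  have hv := v_ne_zero
  have hs := v_sub_ne_zero
  simp only [qInt, two_mul, neg_add, neg_sub, zpow_add₀ hv, zpow_sub₀ hv, zpow_neg, zpow_one]
  have := zpow_ne_zero j hv
  have := zpow_ne_zero n hv
  field_simp
  ring

theorem qInt_sq_sub_sq_mul (n t i : ℤ) :
    qInt (n - i) * (qInt (t + 1) * qInt (t + 1) - qInt (t - i) * qInt (t - i)) =
      qInt (i + 1) *
        (qInt (t - i) * qInt (n + t - i + 1) + qInt n + qInt t * qInt (n - t - 1)) := by
  have hv := v_ne_zero
  have hs := v_sub_ne_zero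
  simp only [qInt, neg_add, neg_sub, zpow_add₀ hv, zpow_sub₀ hv, zpow_neg, zpow_one]
  have := zpow_ne_zero i hv
  have := zpow_ne_zero n hv
  have := zpow_ne_zero t hv
  field_simp
  ring

theorem qInt_neg (n : ℤ) : qInt (-n) = -qInt n := by
  rw [qInt, qInt, neg_neg, ← neg_div, neg_sub]

/-! ### Moving powers of `e` past powers of `f` -/

section Commutation

variable {M : Type*} [AddCommGroup M] [Module Qv M] {e f : Module.End Qv M} {wt : ℤ → M → Prop}

theorem wt_pow {c : ℤ} (hf : ∀ n x, wt n x → wt (n + c) (f x)) {n : ℤ} {x : M} (hx : wt n x)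
    (j : ℕ) : wt (n + j * c) ((f ^ j) x) := by
  induction j with
  | zero => simpa using hx
  | succ j ih =>
    rw [pow_succ', Module.End.mul_apply]
    have := hf _ _ ih
    rwa [show n + ((j + 1 : ℕ) : ℤ) * c = n + j * c + c by push_cast; ring]

/-- Moving `e` through `f^j` collects `[n] + [n-2] + ⋯ + [n-2(j-1)] = [j][n+1-j]`. -/
theorem lower_raise_pow (hf : ∀ n x, wt n x → wt (n + (-2)) (f x))
    (hef : ∀ n x, wt n x → e (f x) = f (e x) + qInt n • x) {n : ℤ} {y : M} (hy : wt n y) (j : ℕ) :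
    f (e ((f ^ j) y)) = (f ^ (j + 1)) (e y) + (qInt j * qInt (n + 1 - j)) • (f ^ j) y := by
  induction j with
  | zero => simp
  | succ j ih =>
    have h1 := hef _ _ (wt_pow hf hy j)
    rw [pow_succ' f j, Module.End.mul_apply, h1, ih, map_add, map_add, map_smul, map_smul,
      pow_succ' f (j + 1), Module.End.mul_apply, add_assoc, ← add_smul]
    congr 2
    have h2 := qInt_mul_add j n
    push_cast
    rw [show n + 1 - ((j : ℤ) + 1) = n - j by ring, ← h2]
    ring_nf

theorem sum_shift (b : ℕ → M) (c c' γ : ℕ → Qv) (t : ℕ) (h0 : c' 0 = c 0 * γ 0)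
    (h : ∀ j < t, c' (j + 1) = c j + c (j + 1) * γ (j + 1)) (ht : c' (t + 1) = c t) :
    ∑ j ∈ Finset.range (t + 1), c j • (b (j + 1) + γ j • b j) =
      ∑ j ∈ Finset.range (t + 2), c' j • b j := by
  have hs : ∑ j ∈ Finset.range t, c' (j + 1) • b (j + 1) =
      ∑ j ∈ Finset.range t, c j • b (j + 1) +
        ∑ j ∈ Finset.range t, (c (j + 1) * γ (j + 1)) • b (j + 1) := by
    rw [← Finset.sum_add_distrib]
    exact Finset.sum_congr rfl fun j hj => by rw [h j (Finset.mem_range.mp hj), add_smul]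
  simp only [smul_add, smul_smul]
  rw [Finset.sum_add_distrib, Finset.sum_range_succ' (fun j => (c j * γ j) • b j),
    Finset.sum_range_succ' (fun j => c' j • b j), Finset.sum_range_succ (fun j => c j • b (j + 1)),
    Finset.sum_range_succ (fun j => c' (j + 1) • b (j + 1)), h0, ht, hs]
  abel

/-- The comparison of coefficients in the induction of `raise_pow_lower_pow`, with `t = i + j` and
the common factor `([t]!/[j]!)²` removed. -/
theorem gaussBinom_recursion (n : ℤ) (i j : ℕ) :
    qInt ((i + j : ℕ) + 1) ^ 2 * gaussBinom n (i + 1) =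
      qInt j ^ 2 * gaussBinom n (i + 1) + gaussBinom n i * (qInt j * qInt (n + j + 1) +
        (qInt n - qInt (i + j : ℕ) * qInt ((i + j : ℕ) + 1 - n))) := by
  have h := qInt_sq_sub_sq_mul n (i + j : ℕ) i
  have h1 := qInt_succ_ne_zero i
  have h2 : qInt (((i + j : ℕ) : ℤ) + 1 - n) = -qInt (n - (i + j : ℕ) - 1) := by
    rw [← qInt_neg]
    congr 1
    ring
  rw [show ((i + j : ℕ) : ℤ) - i = j by push_cast; ring,
    show n + ((i + j : ℕ) : ℤ) - i + 1 = n + j + 1 by push_cast; ring] at h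
  rw [gaussBinom_succ, h2]
  field_simp
  linear_combination gaussBinom n i * h

theorem raise_pow_lower_pow (he : ∀ n x, wt n x → wt (n + 2) (e x))
    (hf : ∀ n x, wt n x → wt (n + (-2)) (f x))
    (hef : ∀ n x, wt n x → e (f x) = f (e x) + qInt n • x) {n : ℤ} {x : M} (hx : wt n x) (t : ℕ) :
    (e ^ t) ((f ^ t) x) = ∑ j ∈ Finset.range (t + 1),
      ((qFact t / qFact j) ^ 2 * gaussBinom n (t - j)) • (f ^ j) ((e ^ j) x) := by
  induction t with
  | zero => simp [qFact_zero]
  | succ t ih =>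
    have h1 : (e ^ (t + 1)) ((f ^ (t + 1)) x) = e (f ((e ^ t) ((f ^ t) x))) -
        (qInt t * qInt (t + 1 - n)) • (e ^ t) ((f ^ t) x) := by
      -- The roles of `e` and `f` are exchanged, so weights change sign; the vector is `f^t x`.
      have := lower_raise_pow (e := f) (f := e) (wt := fun n x => wt (-n) x)
        (fun n x h => by simpa [add_comm] using he _ _ h)
        (fun n x h => by rw [hef _ _ h, qInt_neg, neg_smul, neg_add_cancel_right])
        (n := -(n + t * (-2))) (by simpa using wt_pow hf hx t) t
      rw [this, pow_succ' f, Module.End.mul_apply, eq_sub_iff_add_eq]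
      congr 3
      ring_nf
    have hwt : wt n ((e ^ t) ((f ^ t) x)) := by
      have := wt_pow he (wt_pow hf hx t) t
      rwa [show n + (t : ℤ) * (-2) + t * 2 = n by ring] at this
    have h2 (j : ℕ) : f (e ((f ^ j) ((e ^ j) x))) = (f ^ (j + 1)) ((e ^ (j + 1)) x) +
        (qInt j * qInt (n + j + 1)) • (f ^ j) ((e ^ j) x) := by
      rw [lower_raise_pow hf hef (wt_pow he hx j), pow_succ' e, Module.End.mul_apply]
      congr 4
      ring_nf
    rw [h1, hef _ _ hwt, add_sub_assoc, ← sub_smul, ih, map_sum, map_sum, Finset.smul_sum,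
      ← Finset.sum_add_distrib, ← sum_shift (fun j => (f ^ j) ((e ^ j) x))
        (fun j => (qFact t / qFact j) ^ 2 * gaussBinom n (t - j)) _
        (fun j => qInt j * qInt (n + j + 1) + (qInt n - qInt t * qInt (t + 1 - n))) t]
    · refine Finset.sum_congr rfl fun j _ => ?_
      rw [map_smul, map_smul, h2, smul_comm (qInt n - _), add_smul, smul_add, smul_add, smul_add,
        add_assoc]
    · have := gaussBinom_recursion n t 0
      simp only [add_zero, Nat.cast_zero, qInt_zero, zero_mul, zero_add, Nat.sub_zero, qFact_zero,
        qFact_succ] at this ⊢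
      linear_combination qFact t ^ 2 * this
    · intro j hj
      obtain ⟨i, rfl⟩ : ∃ i, t = i + (j + 1) := ⟨t - (j + 1), by omega⟩
      have := gaussBinom_recursion n i (j + 1)
      rw [show i + (j + 1) + 1 - (j + 1) = i + 1 by omega, show i + (j + 1) - j = i + 1 by omega,
        show i + (j + 1) - (j + 1) = i by omega, qFact_succ, qFact_succ]
      have h3 := qFact_ne_zero j
      have h4 := qInt_succ_ne_zero j
      push_cast at this ⊢
      field_simp
      linear_combination qFact (i + (j + 1)) ^ 2 * this
    · simp [div_self (qFact_ne_zero _)]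

end Commutation

/-- The integral quantum Schur algebra in matrix form. -/
def intRep (d : ℕ) : Subalgebra A (Mat d) := UA.map ((rep d).restrictScalars A)

theorem divPow_e_mem (d m : ℕ) : divPow (rep d U.e) m ∈ intRep d :=
  ⟨divPow U.e m, Algebra.subset_adjoin (Or.inl (Or.inl ⟨m, rfl⟩)), map_divPow (rep d) _ _⟩

theorem divPow_f_mem (d m : ℕ) : divPow (rep d U.f) m ∈ intRep d :=
  ⟨divPow U.f m, Algebra.subset_adjoin (Or.inl (Or.inr ⟨m, rfl⟩)), map_divPow (rep d) _ _⟩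

theorem rep_K1_mem_intRep (d : ℕ) : rep d U.K1 ∈ intRep d :=
  ⟨U.K1, Algebra.subset_adjoin (Or.inr (Or.inl rfl)), rfl⟩

theorem rep_K1_inv_mem_intRep (d : ℕ) : rep d (U.K1⁻¹ : Uˣ) ∈ intRep d :=
  ⟨(U.K1⁻¹ : Uˣ), Algebra.subset_adjoin (Or.inr (Or.inr (Or.inl rfl))), rfl⟩

/-- Vectors of weight `n` for the action of `K`. -/
def HasWeight (d : ℕ) (n : ℤ) (x : W d → Qv) : Prop :=
  Matrix.mulVecLin (rep d U.K) x = v ^ n • x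

theorem mulVecLin_mul_apply {d : ℕ} (x y : Mat d) (z : W d → Qv) :
    Matrix.mulVecLin (x * y) z = Matrix.mulVecLin x (Matrix.mulVecLin y z) := by
  simp

theorem mulVecLin_smul_apply {d : ℕ} (c : Qv) (x : Mat d) (z : W d → Qv) :
    Matrix.mulVecLin (c • x) z = c • Matrix.mulVecLin x z := by
  simp

theorem mulVecLin_sum_apply {d : ℕ} {ι : Type*} (t : Finset ι) (x : ι → Mat d) (z : W d → Qv) :
    Matrix.mulVecLin (∑ i ∈ t, x i) z = ∑ i ∈ t, Matrix.mulVecLin (x i) z := by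
  simp only [Matrix.mulVecLin_apply, Matrix.sum_mulVec]

theorem mulVecLin_pow_apply {d : ℕ} (x : Mat d) (n : ℕ) (z : W d → Qv) :
    Matrix.mulVecLin (x ^ n) z = (Matrix.mulVecLin x ^ n : Module.End Qv (W d → Qv)) z := by
  induction n generalizing z with
  | zero => simp
  | succ n ih => rw [pow_succ, mulVecLin_mul_apply, ih, pow_succ, Module.End.mul_apply]

theorem HasWeight.of_skew {d : ℕ} {n c : ℤ} {u : U} (hu : (U.K : U) * u = v ^ c • (u * (U.K : U)))
    {x : W d → Qv} (hx : HasWeight d n x) :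
    HasWeight d (n + c) (Matrix.mulVecLin (rep d u) x) := by
  rw [HasWeight] at hx ⊢
  rw [← mulVecLin_mul_apply, ← map_mul, hu, map_smul, map_mul, mulVecLin_smul_apply,
    mulVecLin_mul_apply, hx, map_smul, smul_smul, zpow_add₀ v_ne_zero, mul_comm]

theorem HasWeight.commutator {d : ℕ} {n : ℤ} {x : W d → Qv} (hx : HasWeight d n x) :
    Matrix.mulVecLin (rep d U.e) (Matrix.mulVecLin (rep d U.f) x) =
      Matrix.mulVecLin (rep d U.f) (Matrix.mulVecLin (rep d U.e) x) + qInt n • x := by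
  have hinv : Matrix.mulVecLin (rep d (U.K⁻¹ : Uˣ)) x = v ^ (-n) • x := by
    have h1 : Matrix.mulVecLin (rep d (U.K⁻¹ : Uˣ)) (Matrix.mulVecLin (rep d U.K) x) = x := by
      rw [← mulVecLin_mul_apply, ← map_mul, Units.inv_mul, map_one, Matrix.mulVecLin_one,
        LinearMap.id_apply]
    rw [HasWeight] at hx
    rw [hx, map_smul] at h1
    rw [zpow_neg, eq_inv_smul_iff₀ (zpow_ne_zero _ v_ne_zero), h1]
  have h := congrArg (fun y => Matrix.mulVecLin (rep d y) x) U.e_f'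
  simp only [map_sub, map_mul, map_smul, LinearMap.sub_apply, LinearMap.smul_apply] at h
  change Matrix.mulVecLin _ x - Matrix.mulVecLin _ x =
    (v - v⁻¹)⁻¹ • (Matrix.mulVecLin _ x - Matrix.mulVecLin _ x) at h
  rw [mulVecLin_mul_apply, mulVecLin_mul_apply, hinv, hx, ← sub_smul, smul_smul,
    ← div_eq_inv_mul, sub_eq_iff_eq_add'] at h
  exact h

theorem hasWeight_single (d : ℕ) (w : W d) :
    HasWeight d ((cnt 0 w : ℤ) - cnt 1 w) (Pi.single w 1) := by
  rw [HasWeight, rep_K, Matrix.mulVecLin_apply, Matrix.diagonal_mulVec_single, mul_one,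
    ← Pi.single_smul, smul_eq_mul, mul_one]

/-- Columns can be compared one at a time, and each basis word is a weight vector for `K`. -/
theorem divPow_e_mul_divPow_f (d t : ℕ) : divPow (rep d U.e) t * divPow (rep d U.f) t =
    ∑ j ∈ Finset.range (t + 1), divPow (rep d U.f) j * divPow (rep d U.e) j *
      Matrix.diagonal fun w => gaussBinom ((cnt 0 w : ℤ) - cnt 1 w) (t - j) := by
  refine Matrix.ext_of_mulVec_single fun w => ?_
  have hsingle (c : Qv) : (Pi.single w c : W d → Qv) = c • Pi.single w 1 := by
    rw [← Pi.single_smul, smul_eq_mul, mul_one]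
  have h := raise_pow_lower_pow (wt := HasWeight d) (e := Matrix.mulVecLin (rep d U.e))
    (f := Matrix.mulVecLin (rep d U.f))
    (fun n x hx => hx.of_skew (by rw [U.K_e, zpow_two]))
    (fun n x hx => hx.of_skew (by rw [U.K_f, zpow_neg, zpow_two]))
    (fun n x hx => hx.commutator) (hasWeight_single d w) t
  rw [← Matrix.mulVecLin_apply, ← Matrix.mulVecLin_apply, mulVecLin_mul_apply, divPow, divPow,
    mulVecLin_smul_apply, mulVecLin_smul_apply, map_smul, mulVecLin_pow_apply, mulVecLin_pow_apply,
    h, mulVecLin_sum_apply, Finset.smul_sum, Finset.smul_sum]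
  refine Finset.sum_congr rfl fun j _ => ?_
  rw [mulVecLin_mul_apply, mulVecLin_mul_apply, Matrix.mulVecLin_apply (Matrix.diagonal _),
    Matrix.diagonal_mulVec_single, mul_one, divPow, divPow, mulVecLin_smul_apply,
    mulVecLin_smul_apply, hsingle (gaussBinom _ _), map_smul, map_smul, map_smul,
    mulVecLin_pow_apply, mulVecLin_pow_apply, smul_smul, smul_smul, smul_smul, smul_smul]
  congr 1
  have h1 := qFact_ne_zero t
  have h2 := qFact_ne_zero j
  field_simp

/-! ### Integral functions of the weight -/

/-- The functions `F` of the number of zeros for which the diagonal matrix with entries given by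
`F` lies in the integral quantum Schur algebra. -/
def intFun (d : ℕ) : Subalgebra A (ℕ → Qv) :=
  (intRep d).comap ((diagCnt d).restrictScalars A)

theorem mem_intFun {d : ℕ} {F : ℕ → Qv} :
    F ∈ intFun d ↔ Matrix.diagonal (fun w : W d => F (cnt 0 w)) ∈ intRep d := Iff.rfl

theorem cnt_zero_le {d : ℕ} (w : W d) : cnt 0 w ≤ d := by
  have := cnt_add_cnt w
  omega

theorem intFun_congr {d : ℕ} {F G : ℕ → Qv} (hF : F ∈ intFun d) (h : ∀ m ≤ d, F m = G m) :
    G ∈ intFun d := by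
  rw [mem_intFun] at hF ⊢
  convert hF using 3 with w
  exact (h _ (cnt_zero_le w)).symm

theorem intFun_smul {d : ℕ} {F : ℕ → Qv} (hF : F ∈ intFun d) {c : Qv} (hc : c ∈ intRing) :
    c • F ∈ intFun d := by
  obtain ⟨a, rfl⟩ := hc
  rw [algebraMap_smul]
  exact Subalgebra.smul_mem _ hF a

theorem zpow_mem_intFun (d : ℕ) (k : ℤ) : (fun m : ℕ => v ^ (k * m)) ∈ intFun d := by
  have h1 : (fun m : ℕ => v ^ (m : ℤ)) ∈ intFun d := by
    rw [mem_intFun, ← rep_K1]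
    exact rep_K1_mem_intRep d
  have h2 : (fun m : ℕ => v ^ (-(m : ℤ))) ∈ intFun d := by
    rw [mem_intFun, ← rep_K1_inv]
    exact rep_K1_inv_mem_intRep d
  obtain ⟨n, rfl | rfl⟩ := k.eq_nat_or_neg
  · convert pow_mem h1 n using 1
    ext m
    rw [Pi.pow_apply, ← zpow_natCast, ← zpow_mul, mul_comm]
  · convert pow_mem h2 n using 1
    ext m
    rw [Pi.pow_apply, ← zpow_natCast, ← zpow_mul, mul_comm, mul_neg, neg_mul]

theorem gaussBinom_weight_mem (d t : ℕ) :
    (fun m : ℕ => gaussBinom (2 * m - d) t) ∈ intFun d := by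
  induction t using Nat.strong_induction_on with
  | _ t ih =>
    have hw (w : W d) : (cnt 0 w : ℤ) - cnt 1 w = 2 * cnt 0 w - d := by
      have := cnt_add_cnt w
      omega
    have h := divPow_e_mul_divPow_f d t
    simp only [hw] at h
    -- The term `j = 0` is the diagonal matrix sought; all others have a smaller lower index `t - j`
    -- and fall under the induction hypothesis.
    rw [Finset.sum_range_succ', divPow_zero, divPow_zero, one_mul, one_mul, Nat.sub_zero,
      ← sub_eq_iff_eq_add'] at h
    rw [mem_intFun, ← h]
    refine sub_mem (mul_mem (divPow_e_mem d t) (divPow_f_mem d t)) (sum_mem fun j hj => ?_)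
    have := Finset.mem_range.mp hj
    exact mul_mem (mul_mem (divPow_f_mem d _) (divPow_e_mem d _))
      (mem_intFun.mp (ih (t - (j + 1)) (by omega)))

/-- Pascal's rule raises the upper index by one, and its coefficient depends on `m` only through
`v^(-2m)`, which comes from `K₁⁻²`. -/
theorem gaussBinom_shift_mem (d t r : ℕ) :
    (fun m : ℕ => gaussBinom (2 * m - d + r) t) ∈ intFun d := by
  induction r generalizing t with
  | zero => simpa using gaussBinom_weight_mem d t
  | succ r ih =>
    cases t with
    | zero =>
      simp only [gaussBinom_zero]
      exact one_mem (intFun d)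
    | succ t =>
      have h1 := intFun_smul (ih (t + 1)) (zpow_v_mem ((t : ℤ) + 1))
      have h2 := intFun_smul (mul_mem (zpow_mem_intFun d (-2)) (ih t))
        (zpow_v_mem ((t : ℤ) + d - r))
      convert add_mem h1 h2 using 1
      ext m
      simp only [Pi.add_apply, Pi.smul_apply, Pi.mul_apply, smul_eq_mul]
      rw [← mul_assoc (v ^ _) (v ^ _), ← zpow_add₀ v_ne_zero, Nat.cast_succ, ← add_assoc,
        gaussBinom_pascal]
      congr 3
      ring

/-- The binomial with upper index `2m` and lower index `2k` is `0` for `m < k` and `1` for `m = k`.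
Subtracting its values at `m > k` times the projections already obtained leaves the projection at
`k`, so the induction descends from `k = d`. -/
theorem projection_mem {d k : ℕ} (hk : k ≤ d) : (Pi.single k 1 : ℕ → Qv) ∈ intFun d := by
  obtain ⟨i, rfl⟩ : ∃ i, d = k + i := ⟨d - k, by omega⟩
  induction i using Nat.strong_induction_on generalizing k with
  | _ i ih =>
    -- The shift by `d` replaces the upper index `2m - d` by the natural number `2m`, where the
    -- binomial vanishes for `m < k`.
    have hF := gaussBinom_shift_mem (k + i) (2 * k) (k + i)
    have hsum := sum_mem (S := intFun (k + i)) (t := Finset.Ioc k (k + i))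
      (f := fun m => gaussBinom ((2 * m : ℕ) : ℤ) (2 * k) • (Pi.single m 1 : ℕ → Qv))
      (fun m hm => by
        have := Finset.mem_Ioc.mp hm
        obtain ⟨j, hj⟩ : ∃ j, k + i = m + j := ⟨k + i - m, by omega⟩
        have := ih j (by omega) (k := m) (by omega)
        rw [hj]
        exact intFun_smul this (gaussBinom_mem _ _))
    refine intFun_congr (sub_mem hF hsum) fun m hm => ?_
    have h2 : (2 * (m : ℤ) - (k + i : ℕ) + (k + i : ℕ)) = ((2 * m : ℕ) : ℤ) := by push_cast; ring
    rw [Pi.sub_apply, Finset.sum_apply, h2]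
    simp only [Pi.smul_apply, smul_eq_mul, Pi.single_apply, mul_ite, mul_one, mul_zero]
    rw [Finset.sum_ite_eq]
    rcases lt_trichotomy m k with h | rfl | h
    · rw [gaussBinom_eq_zero (by omega), if_neg (by simp; omega), if_neg (by omega), sub_zero]
    · rw [gaussBinom_self, if_neg (by simp), if_pos rfl, sub_zero]
    · rw [if_pos (by simp; omega), if_neg (by omega), sub_self]

theorem mem_intFun_of_integral {d : ℕ} {F : ℕ → Qv} (h : ∀ m ≤ d, F m ∈ intRing) :
    F ∈ intFun d := by
  have hsum := sum_mem (S := intFun d) (t := Finset.range (d + 1))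
    (f := fun m => F m • (Pi.single m 1 : ℕ → Qv)) (fun m hm => by
      have := Finset.mem_range_succ_iff.mp hm
      exact intFun_smul (projection_mem this) (h m this))
  refine intFun_congr hsum fun m hm => ?_
  rw [Finset.sum_apply]
  simp only [Pi.smul_apply, smul_eq_mul, Pi.single_apply, mul_ite, mul_one, mul_zero]
  rw [Finset.sum_ite_eq, if_pos (by simp; omega)]

theorem diagonal_gaussBinom_mem (s : Fin 2) (d t : ℕ) :
    (Matrix.diagonal fun w : W d => gaussBinom (cnt s w) t) ∈ intRep d := by
  fin_cases s
  · exact mem_intFun.mp (mem_intFun_of_integral fun m _ => gaussBinom_mem m t)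
  -- The number of letters `1` is `d - m`; truncated subtraction is harmless as `m ≤ d`.
  · have h := mem_intFun.mp (mem_intFun_of_integral (d := d) fun m _ => gaussBinom_mem (d - m) t)
    convert h using 3 with w
    have := cnt_add_cnt w
    change gaussBinom (cnt 1 w) t = _
    congr 2
    omega

/-! ### The basis theorem -/

theorem intRep_le {d : ℕ} (T : Subalgebra A (Mat d)) (he : ∀ m, divPow (rep d U.e) m ∈ T)
    (hf : ∀ m, divPow (rep d U.f) m ∈ T) (h1 : rep d U.K1 ∈ T) (h1' : rep d (U.K1⁻¹ : Uˣ) ∈ T)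
    (h2 : rep d U.K2 ∈ T) (h2' : rep d (U.K2⁻¹ : Uˣ) ∈ T) : intRep d ≤ T := by
  rw [intRep, Subalgebra.map_le]
  refine Algebra.adjoin_le ?_
  rintro _ ((⟨m, rfl⟩ | ⟨m, rfl⟩) | h)
  · exact (congrArg (· ∈ T) (map_divPow (rep d) U.e m)).mpr (he m)
  · exact (congrArg (· ∈ T) (map_divPow (rep d) U.f m)).mpr (hf m)
  · obtain rfl | rfl | rfl | rfl := h
    · exact h1
    · exact h1'
    · exact h2
    · exact h2'

theorem mem_heckeCommutant_of_mem_intRep {d : ℕ} {x : Mat d} (hx : x ∈ intRep d) :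
    x ∈ heckeCommutant d :=
  intRep_le ((heckeCommutant d).restrictScalars A)
    (fun m => (heckeCommutant d).smul_mem (pow_mem (rep_e_mem d) m) _)
    (fun m => (heckeCommutant d).smul_mem (pow_mem (rep_f_mem d) m) _)
    (rep_K1_mem d) (rep_K1_inv_mem d) (rep_K2_mem d) (rep_K2_inv_mem d) hx

/-- The matrices with entries in `𝒜`. -/
def integralMat (d : ℕ) : Subalgebra A (Mat d) := ((Algebra.ofId A Qv).mapMatrix).range

theorem mem_integralMat {d : ℕ} {x : Mat d} : x ∈ integralMat d ↔ ∀ w' w, x w' w ∈ intRing := by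
  constructor
  · rintro ⟨y, rfl⟩ w' w
    exact ⟨y w' w, rfl⟩
  · intro h
    choose y hy using h
    exact ⟨Matrix.of y, Matrix.ext hy⟩

theorem Raises.mem_integralMat {s : Fin 2} {d : ℕ} {X : ℕ → Mat d} (hX : Raises s X) (a : ℕ) :
    X a ∈ integralMat d := by
  refine QSchur.mem_integralMat.mpr fun w' w => ?_
  obtain ⟨h1, h2⟩ := hX a w' w
  by_cases h : X a w' w = 0
  · rw [h]
    exact zero_mem _
  · obtain ⟨h3, h4⟩ := h2 h
    obtain ⟨k, hk⟩ := h1 h3 h4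
    rw [hk]
    exact zpow_v_mem k

theorem diagonal_mem_integralMat {d : ℕ} (n : W d → ℤ) :
    (Matrix.diagonal fun w => v ^ n w) ∈ integralMat d := by
  refine mem_integralMat.mpr fun w' w => ?_
  rw [Matrix.diagonal_apply]
  split_ifs
  · exact zpow_v_mem _
  · exact zero_mem _

/-- Every generator of `UA` acts by a matrix whose entries are zero or powers of `v`. -/
theorem apply_mem_intRing {d : ℕ} {x : Mat d} (hx : x ∈ intRep d) (w' w : W d) :
    x w' w ∈ intRing :=
  mem_integralMat.mp (intRep_le (integralMat d) (raises_e d).mem_integralMat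
    (raises_f d).mem_integralMat (rep_K1 d ▸ diagonal_mem_integralMat _)
    (rep_K1_inv d ▸ diagonal_mem_integralMat _) (rep_K2 d ▸ diagonal_mem_integralMat _)
    (rep_K2_inv d ▸ diagonal_mem_integralMat _) hx) w' w

theorem mem_SA_iff {d : ℕ} {x : Module.End Qv (TE d)} : x ∈ SA d ↔ mat d x ∈ intRep d := by
  constructor
  · rintro ⟨u, hu, rfl⟩
    exact ⟨u, hu, rfl⟩
  · rintro ⟨u, hu, h⟩
    exact ⟨u, hu, (mat d).injective h⟩

/-- Independence kills coefficients in increasing rank. For spanning, the integral values `φ i x`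
are matched rank by rank, and the remainder is zero because the `φ i` separate points. -/
theorem exists_basis_of_triangular {R K N I : Type*} [CommRing R] [CommRing K] [Algebra R K]
    [FaithfulSMul R K] [AddCommGroup N] [Module R N] [Fintype I] (b : I → N)
    (φ : I → N →+ K) (r : I → ℕ)
    (hφ : ∀ i (a : R) x, φ i (a • x) = algebraMap R K a * φ i x)
    (hinj : ∀ x, (∀ i, φ i x = 0) → x = 0)
    (hint : ∀ i x, ∃ a : R, algebraMap R K a = φ i x)
    (hdiag : ∀ i, ∃ u : Rˣ, algebraMap R K u = φ i (b i))
    (htri : ∀ i j, φ i (b j) ≠ 0 → r j < r i ∨ j = i) :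
    ∃ 𝔅 : Module.Basis I R N, ∀ i, 𝔅 i = b i := by
  have hK := FaithfulSMul.algebraMap_injective R K
  have hli : LinearIndependent R b := by
    rw [Fintype.linearIndependent_iff]
    intro c hc
    have key : ∀ n i, r i = n → c i = 0 := by
      intro n
      induction n using Nat.strong_induction_on with
      | _ n ih =>
        intro i hi
        have h := congrArg (φ i) hc
        rw [map_sum, map_zero, Finset.sum_eq_single i ?_ (by simp), hφ] at h
        · obtain ⟨u, hu⟩ := hdiag i
          rw [← hu, ← map_mul, map_eq_zero_iff _ hK] at h
          exact (Units.mul_left_eq_zero u).mp h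
        · intro j _ hj
          rw [hφ]
          by_cases h0 : φ i (b j) = 0
          · rw [h0, mul_zero]
          · rw [ih (r j) (hi ▸ (htri i j h0).resolve_right hj) j rfl, map_zero, zero_mul]
    exact fun i => key _ i rfl
  have hspan : ⊤ ≤ Submodule.span R (Set.range b) := by
    intro x _
    have key : ∀ n, ∃ y ∈ Submodule.span R (Set.range b), ∀ i, r i < n → φ i (x - y) = 0 := by
      intro n
      induction n with
      | zero => exact ⟨0, zero_mem _, fun i hi => absurd hi (Nat.not_lt_zero _)⟩
      | succ n ih =>
        obtain ⟨y, hy, hyx⟩ := ih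
        choose a ha using fun i => hint i (x - y)
        choose u hu using hdiag
        -- Dividing by the unit `φ j (b j)` corrects all values of rank `n`; by triangularity the
        -- correction at `j` affects no other index of rank at most `n`.
        refine ⟨y + ∑ j ∈ Finset.univ.filter (fun j => r j = n),
          (a j * ((u j)⁻¹ : Rˣ)) • b j, add_mem hy (sum_mem fun j _ =>
            Submodule.smul_mem _ _ (Submodule.subset_span ⟨j, rfl⟩)), fun i hi => ?_⟩
        rw [← sub_sub, map_sub, map_sum]
        have hz : ∀ j ∈ Finset.univ.filter (fun j => r j = n), j ≠ i →
            φ i ((a j * ((u j)⁻¹ : Rˣ)) • b j) = 0 := by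
          intro j hj hji
          have hj' := (Finset.mem_filter.mp hj).2
          rw [hφ]
          by_cases h0 : φ i (b j) = 0
          · rw [h0, mul_zero]
          · have := (htri i j h0).resolve_right hji
            omega
        rcases Nat.lt_succ_iff_lt_or_eq.mp hi with h | h
        · rw [hyx i h, Finset.sum_eq_zero fun j hj => hz j hj ?_, sub_zero]
          rintro rfl
          have := (Finset.mem_filter.mp hj).2
          omega
        · rw [Finset.sum_eq_single_of_mem i (by simp [h]) hz, hφ, ← hu, ← ha, ← map_mul,
            mul_assoc, Units.inv_mul, mul_one, sub_self]
    obtain ⟨y, hy, hyx⟩ := key (Finset.univ.sup r + 1)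
    have : x - y = 0 :=
      hinj _ fun i => hyx i (Nat.lt_succ_of_le (Finset.le_sup (Finset.mem_univ i)))
    rwa [sub_eq_zero.mp this]
  exact ⟨Module.Basis.mk hli hspan, fun i => by rw [Module.Basis.mk_apply]⟩

instance (d : ℕ) : Finite (Idx d) :=
  Finite.of_injective
    (fun p : Idx d => ((⟨p.1.1, by omega⟩, ⟨p.1.2.1, by omega⟩, ⟨p.1.2.2, by omega⟩) :
      Fin (d + 1) × Fin (d + 1) × Fin (d + 1)))
    (by
      rintro ⟨⟨a, b, c⟩, h⟩ ⟨⟨a', b', c'⟩, h'⟩ heq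
      simpa using heq)

/-! ### Orbit representatives -/

theorem eq_zero_one_or {s s' : Fin 2} (h : s' ≠ s) : s = 0 ∧ s' = 1 ∨ s = 1 ∧ s' = 0 := by omega

theorem letterLE_swap {s s' : Fin 2} (h : s' ≠ s) {d : ℕ} {u w : W d} :
    LetterLE s' w u ↔ LetterLE s u w := by
  induction d with
  | zero => exact Iff.rfl
  | succ d ih =>
    refine and_congr ih ?_
    constructor <;> intro h1 h2 <;> by_contra h3 <;> omega

theorem cnt_add_cnt_of_ne {s s' : Fin 2} (h : s' ≠ s) {d : ℕ} (w : W d) :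
    cnt s w + cnt s' w = d := by
  rcases eq_zero_one_or h with ⟨rfl, rfl⟩ | ⟨rfl, rfl⟩
  · exact cnt_add_cnt w
  · rw [add_comm, cnt_add_cnt w]

/-- Read backwards, turning letters into `s'` is turning letters into `s`. Both outer factors of a
monomial then constrain the middle word by the same relation `LetterLE s`. -/
theorem Raises.transpose {s s' : Fin 2} (h : s' ≠ s) {d : ℕ} {Y : ℕ → Mat d} (hY : Raises s' Y) :
    Raises s fun a => (Y a).transpose := by
  intro a w' w
  have h1 := hY a w w'
  have h2 := cnt_add_cnt_of_ne h w
  have h3 := cnt_add_cnt_of_ne h w'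
  rw [letterLE_swap h] at h1
  exact ⟨fun hle hc => h1.1 hle (by omega),
    fun hne => ⟨(h1.2 hne).1, by have := (h1.2 hne).2; omega⟩⟩

/-- The word with letter `s` where both words have letter `s`, and `s'` elsewhere. -/
def meet (s s' : Fin 2) : ∀ {d : ℕ}, W d → W d → W d
  | 0, _, _ => ()
  | _ + 1, w', w => (meet s s' w'.1 w.1, if w'.2 = s ∧ w.2 = s then s else s')

theorem letterLE_meet {s s' : Fin 2} (h : s' ≠ s) {d : ℕ} {u w' w : W d} :
    LetterLE s u (meet s s' w' w) ↔ LetterLE s u w' ∧ LetterLE s u w := by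
  induction d with
  | zero => exact ⟨fun _ => ⟨trivial, trivial⟩, fun _ => trivial⟩
  | succ d ih =>
    change LetterLE s u.1 (meet s s' w'.1 w.1) ∧
      (u.2 = s → (if w'.2 = s ∧ w.2 = s then s else s') = s)
      ↔ (LetterLE s u.1 w'.1 ∧ (u.2 = s → w'.2 = s)) ∧ LetterLE s u.1 w.1 ∧ (u.2 = s → w.2 = s)
    rw [ih]
    split_ifs with hc
    · tauto
    · tauto

theorem cnt_meet {s s' : Fin 2} (h : s' ≠ s) {d : ℕ} (w' w : W d) :
    cnt s (meet s s' w' w) = (labels w' w).count (s, s) := by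
  induction d with
  | zero => rfl
  | succ d ih =>
    change cnt s (meet s s' w'.1 w.1) +
        (if (if w'.2 = s ∧ w.2 = s then s else s') = s then 1 else 0) =
      ((w'.2, w.2) :: labels w'.1 w.1).count (s, s)
    rw [ih, List.count_cons]
    simp [h]

theorem cnt_left {s s' : Fin 2} (h : s' ≠ s) {d : ℕ} (w' w : W d) :
    cnt s w' = (labels w' w).count (s, s) + (labels w' w).count (s, s') := by
  induction d with
  | zero => rfl
  | succ d ih =>
    obtain ⟨w', i'⟩ := w'
    obtain ⟨w, i⟩ := w
    change cnt s (w'.snoc i') = List.count (s, s) ((i', i) :: labels w' w) +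
      List.count (s, s') ((i', i) :: labels w' w)
    rw [cnt_snoc, ih w' w, List.count_cons, List.count_cons]
    rcases eq_zero_one_or h with ⟨rfl, rfl⟩ | ⟨rfl, rfl⟩ <;> fin_cases i' <;> fin_cases i <;>
      simp <;> omega

theorem cnt_right {s s' : Fin 2} (h : s' ≠ s) {d : ℕ} (w' w : W d) :
    cnt s w = (labels w' w).count (s, s) + (labels w' w).count (s', s) := by
  induction d with
  | zero => rfl
  | succ d ih =>
    obtain ⟨w', i'⟩ := w'
    obtain ⟨w, i⟩ := w
    change cnt s (w.snoc i) = List.count (s, s) ((i', i) :: labels w' w) +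
      List.count (s', s) ((i', i) :: labels w' w)
    rw [cnt_snoc, ih w' w, List.count_cons, List.count_cons]
    rcases eq_zero_one_or h with ⟨rfl, rfl⟩ | ⟨rfl, rfl⟩ <;> fin_cases i' <;> fin_cases i <;>
      simp <;> omega

theorem length_eq_sum_count {s s' : Fin 2} (h : s' ≠ s) (L : List (Fin 2 × Fin 2)) :
    L.length = L.count (s, s) + L.count (s, s') + L.count (s', s) + L.count (s', s') := by
  induction L with
  | nil => rfl
  | cons a L ih =>
    obtain ⟨i', i⟩ := a
    rw [List.length_cons, ih, List.count_cons, List.count_cons, List.count_cons, List.count_cons]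
    rcases eq_zero_one_or h with ⟨rfl, rfl⟩ | ⟨rfl, rfl⟩ <;> fin_cases i' <;> fin_cases i <;>
      simp <;> omega

/-- The representative label list with prescribed multiplicities. -/
def labelList (s s' : Fin 2) {d : ℕ} (p : Idx d) : List (Fin 2 × Fin 2) :=
  List.replicate p.1.2.1 (s, s) ++ List.replicate p.1.1 (s, s') ++
    List.replicate p.1.2.2 (s', s) ++ List.replicate (d - (p.1.1 + p.1.2.1 + p.1.2.2)) (s', s')

theorem length_labelList (s s' : Fin 2) {d : ℕ} (p : Idx d) : (labelList s s' p).length = d := by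
  have := p.2
  simp [labelList]
  omega

theorem count_labelList {s s' : Fin 2} (h : s' ≠ s) {d : ℕ} (p : Idx d) :
    (labelList s s' p).count (s, s) = p.1.2.1 ∧ (labelList s s' p).count (s, s') = p.1.1 ∧
      (labelList s s' p).count (s', s) = p.1.2.2 := by
  rcases eq_zero_one_or h with ⟨rfl, rfl⟩ | ⟨rfl, rfl⟩ <;>
    simp [labelList, List.count_replicate]

/-- The length determines the multiplicity of `(s', s')`, so the other three counts fix a list up to
permutation. -/
theorem exists_labelList_perm {s s' : Fin 2} (h : s' ≠ s) {d : ℕ} {L : List (Fin 2 × Fin 2)}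
    (hL : L.length = d) : ∃ p : Idx d, (labelList s s' p).Perm L := by
  have hsum := length_eq_sum_count h L
  refine ⟨⟨(L.count (s, s'), L.count (s, s), L.count (s', s)), by dsimp only; omega⟩, ?_⟩
  have hlen := length_eq_sum_count h (labelList s s' (d := d)
    ⟨(L.count (s, s'), L.count (s, s), L.count (s', s)), by dsimp only; omega⟩)
  obtain ⟨h1, h2, h3⟩ := count_labelList h (d := d)
    ⟨(L.count (s, s'), L.count (s, s), L.count (s', s)), by dsimp only; omega⟩
  rw [length_labelList, h1, h2, h3] at hlen
  dsimp only at h1 h2 h3 hlen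
  rw [List.perm_iff_count]
  rintro ⟨i', i⟩
  by_cases hi' : i' = s <;> by_cases hi : i = s
  · rw [hi, hi', h1]
  · rw [hi', show i = s' by omega, h2]
  · rw [hi, show i' = s' by omega, h3]
  · rw [show i' = s' by omega, show i = s' by omega]
    omega

theorem exists_basis {s s' : Fin 2} (hs : s' ≠ s) {d : ℕ} (X Z Y : ℕ → Module.End Qv (TE d))
    (hX : Raises s fun a => mat d (X a)) (hY : Raises s' fun a => mat d (Y a))
    (hZ : ∀ b, mat d (Z b) = Matrix.diagonal fun w => gaussBinom (cnt s w) b)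
    (hX' : ∀ a, mat d (X a) ∈ intRep d) (hY' : ∀ a, mat d (Y a) ∈ intRep d) :
    ∃ 𝔅 : Module.Basis (Idx d) A (SA d), ∀ p : Idx d,
      ((𝔅 p : SA d) : Module.End Qv (TE d)) = X p.1.1 * Z p.1.2.1 * Y p.1.2.2 := by
  have := Fintype.ofFinite (Idx d)
  have hmem (p : Idx d) : X p.1.1 * Z p.1.2.1 * Y p.1.2.2 ∈ SA d := by
    rw [mem_SA_iff, map_mul, map_mul, hZ]
    exact mul_mem (mul_mem (hX' _) (diagonal_gaussBinom_mem s d _)) (hY' _)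
  choose w' w hw using fun p : Idx d => exists_labels_eq _ (length_labelList s s' p)
  let φ (p : Idx d) : SA d →+ Qv :=
    { toFun := fun x => mat d x (w' p) (w p)
      map_zero' := by simp
      map_add' := fun x y => by simp }
  have hφ (p : Idx d) (a : A) (x : SA d) : φ p (a • x) = algebraMap A Qv a * φ p x := by
    change mat d (a • (x : Module.End Qv (TE d))) _ _ = _
    rw [← algebraMap_smul Qv a (x : Module.End Qv (TE d)), map_smul, Matrix.smul_apply, smul_eq_mul]
    rfl
  have hcnt (p : Idx d) : cnt s (meet s s' (w' p) (w p)) = p.1.2.1 ∧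
      cnt s (w' p) = p.1.2.1 + p.1.1 ∧ cnt s (w p) = p.1.2.1 + p.1.2.2 := by
    obtain ⟨h1, h2, h3⟩ := count_labelList hs p
    rw [cnt_meet hs, cnt_left hs (w' p) (w p), cnt_right hs (w' p) (w p), hw, h1, h2, h3]
    exact ⟨rfl, rfl, rfl⟩
  have hentry (p q : Idx d) : φ p ⟨_, hmem q⟩ = ∑ u, mat d (X q.1.1) (w' p) u *
      gaussBinom (cnt s u) q.1.2.1 * mat d (Y q.1.2.2) u (w p) := by
    change mat d (X q.1.1 * Z q.1.2.1 * Y q.1.2.2) (w' p) (w p) = _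
    rw [map_mul, map_mul, hZ, Matrix.mul_apply]
    simp only [Matrix.mul_diagonal]
  -- `Y` removes letters `s` from `w p` to reach `u`, and `X` adds letters `s` to reach `w' p`, so
  -- the letters `s` of `u` are common to both words; the binomial discards `u` with too few of
  -- them.
  have hsupp (p q : Idx d) (u : W d) (hne : mat d (X q.1.1) (w' p) u *
      gaussBinom (cnt s u) q.1.2.1 * mat d (Y q.1.2.2) u (w p) ≠ 0) :
      LetterLE s u (meet s s' (w' p) (w p)) ∧ q.1.2.1 ≤ cnt s u ∧
        cnt s (w' p) = cnt s u + q.1.1 ∧ cnt s (w p) = cnt s u + q.1.2.2 := by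
    obtain ⟨h1, h2⟩ := (hX q.1.1 (w' p) u).2 (left_ne_zero_of_mul (left_ne_zero_of_mul hne))
    obtain ⟨h3, h4⟩ := (hY.transpose hs q.1.2.2 (w p) u).2 (right_ne_zero_of_mul hne)
    refine ⟨(letterLE_meet hs).mpr ⟨h1, h3⟩, ?_, h2, h4⟩
    by_contra hlt
    exact right_ne_zero_of_mul (left_ne_zero_of_mul hne) (gaussBinom_eq_zero (not_le.mp hlt))
  -- Negation is the action of `-1`, so the additive monoid underlying the `A`-module is unchanged.
  let _ : AddCommGroup (SA d) := Module.addCommMonoidToAddCommGroup A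
  refine (exists_basis_of_triangular (R := A) (K := Qv)
    (fun p : Idx d => (⟨_, hmem p⟩ : SA d)) φ (fun p => p.1.2.1) hφ ?_ ?_ ?_ ?_).imp
    fun 𝔅 h𝔅 p => by rw [h𝔅]
  · intro x hx
    have h0 : mat d (x : Module.End Qv (TE d)) = 0 := by
      refine eq_zero_of_vanish_on_representatives
        (mem_heckeCommutant_of_mem_intRep (mem_SA_iff.mp x.2)) fun y' y => ?_
      obtain ⟨p, hp⟩ := exists_labelList_perm hs (length_labels y' y)
      exact ⟨w' p, w p, (hw p).symm ▸ hp, hx p⟩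
    exact Subtype.ext ((map_eq_zero_iff _ (mat d).injective).mp h0)
  · exact fun p x => apply_mem_intRing (mem_SA_iff.mp x.2) _ _
  · intro p
    obtain ⟨hm, h1, h2⟩ := hcnt p
    have hle := (letterLE_meet hs).mp (LetterLE.refl s (meet s s' (w' p) (w p)))
    obtain ⟨k, hk⟩ := (hX p.1.1 (w' p) _).1 hle.1 (by rw [h1, hm])
    obtain ⟨l, hl⟩ := (hY.transpose hs p.1.2.2 (w p) _).1 hle.2 (by rw [h2, hm])
    change mat d (X p.1.1) (w' p) (meet s s' (w' p) (w p)) = v ^ k at hk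
    change mat d (Y p.1.2.2) (meet s s' (w' p) (w p)) (w p) = v ^ l at hl
    refine ⟨(LaurentPolynomial.isUnit_T (k + l)).unit, ?_⟩
    rw [hentry, Finset.sum_eq_single (meet s s' (w' p) (w p)) ?_ (by simp), hm, gaussBinom_self,
      mul_one, hk, hl, IsUnit.unit_spec, algebraMap_T, zpow_add₀ v_ne_zero]
    -- A contributing `u` lies below the meet and has at least as many letters `s`, hence equals it.
    intro u _ hu
    by_contra hne
    obtain ⟨h3, h4, -, -⟩ := hsupp p p u hne
    exact hu (h3.eq_of_cnt_eq (le_antisymm (hm.trans_le h4) h3.cnt_le))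
  · intro p q hne
    rw [hentry] at hne
    obtain ⟨u, -, hu⟩ := Finset.exists_ne_zero_of_sum_ne_zero hne
    obtain ⟨hm, h1, h2⟩ := hcnt p
    obtain ⟨h3, h4, h5, h6⟩ := hsupp p q u hu
    have h7 := h3.cnt_le
    -- If the two middle indices agree, `u` has exactly that many letters `s`, and the counts in `w'
    -- p` and `w p` force the outer indices to agree too.
    rcases lt_or_eq_of_le (h4.trans (h7.trans hm.le)) with h | h
    · exact Or.inl h
    · exact Or.inr (Subtype.ext (Prod.ext (by omega) (Prod.ext h (by omega))))

end QSchur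

end

theorem theorem2p6 (d : ℕ) :
    (∃ 𝔅 : Module.Basis (QSchur.Idx d) QSchur.A (QSchur.SA d),
      ∀ p : QSchur.Idx d, ((𝔅 p : QSchur.SA d) : Module.End QSchur.Qv (QSchur.TE d)) =
        QSchur.divPow (QSchur.eS d) p.1.1 * QSchur.qBinom (QSchur.K1S d) p.1.2.1 *
          QSchur.divPow (QSchur.fS d) p.1.2.2) ∧
    (∃ 𝔅 : Module.Basis (QSchur.Idx d) QSchur.A (QSchur.SA d),
      ∀ p : QSchur.Idx d, ((𝔅 p : QSchur.SA d) : Module.End QSchur.Qv (QSchur.TE d)) =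
        QSchur.divPow (QSchur.fS d) p.1.1 * QSchur.qBinom (QSchur.K2S d) p.1.2.1 *
          QSchur.divPow (QSchur.eS d) p.1.2.2) := by
  have he : QSchur.Raises 0 fun a => QSchur.mat d (QSchur.divPow (QSchur.eS d) a) := by
    simpa only [QSchur.mat_divPow_e] using QSchur.raises_e d
  have hf : QSchur.Raises 1 fun a => QSchur.mat d (QSchur.divPow (QSchur.fS d) a) := by
    simpa only [QSchur.mat_divPow_f] using QSchur.raises_f d
  have he' (a : ℕ) : QSchur.mat d (QSchur.divPow (QSchur.eS d) a) ∈ QSchur.intRep d := by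
    rw [QSchur.mat_divPow_e]
    exact QSchur.divPow_e_mem d a
  have hf' (a : ℕ) : QSchur.mat d (QSchur.divPow (QSchur.fS d) a) ∈ QSchur.intRep d := by
    rw [QSchur.mat_divPow_f]
    exact QSchur.divPow_f_mem d a
  exact ⟨QSchur.exists_basis (by decide) _ _ _ he hf (QSchur.mat_qBinom_K1 d) he' hf',
    QSchur.exists_basis (by decide) _ _ _ hf he (QSchur.mat_qBinom_K2 d) hf' he'⟩
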